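/- **Proposition (duality).** Let $\mathcal H=\mathcal H_+\oplus\mathcal H_-$ be a complex separable Hilbert space, written as the orthogonal sum of two infinite-dimensional closed subspaces, with orthogonal projections $\mathrm{pr}_\pm$ onto $\mathcal H_\pm$, and let $d=i(\mathrm{pr}_+-\mathrm{pr}_-)$. For a bounded operator $\rho$ on $\mathcal H$ let $\rho_{++},\rho_{+-},\rho_{-+},\rho_{--}$ be its blocks with respect to this decomposition ($\rho_{+-}=\mathrm{pr}_+\rho|_{\mathcal H_-}$, etc.). For $1\le p<\infty$ let $L_p$ be the Schatten class of bounded operators $A$ between Hilbert spaces with $\mathrm{Tr}\,(A^*A)^{p/2}<\infty$, with norm $\|A\|_p=(\mathrm{Tr}\,(A^*A)^{p/2})^{1/p}$, and let $L_\infty$ be the space of compact operators with the operator norm. Let $\mathfrak u(\mathcal H)=\{a\in\mathcal B(\mathcal H): a^*=-a\}$ and $$L_{1,q}(\mathcal H)=\{\rho\in\mathcal B(\mathcal H):[d,\rho]\in L_q(\mathcal H),\ \rho_{++}\in L_1(\mathcal H_+),\ \rho_{--}\in L_1(\mathcal H_-)\},$$ $$\|\rho\|_{1,q}=\|\rho_{++}\|_1+\|\rho_{--}\|_1+\|\rho_{+-}\|_q+\|\rho_{-+}\|_q,\qquad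 \mathrm{Tr_{res}}(\rho)=\mathrm{Tr}(\rho_{++})+\mathrm{Tr}(\rho_{--})\quad(\rho\in L_{1,q}(\mathcal H)),$$ $$\mathfrak u_{1,q}=\mathfrak u(\mathcal H)\cap L_{1,q}(\mathcal H)\ \text{ with the norm }\|\cdot\|_{1,q},$$ $$\mathfrak u_{\mathrm{res},p}=\{a\in\mathfrak u(\mathcal H):[d,a]\in L_p(\mathcal H)\}\ \text{ with the norm }\|a\|_{\mathrm{res},p}=\|a\|+\|[d,a]\|_p .$$ Let $1<p\le 2$ and $\frac1p+\frac1q=1$, or let $p=1$ and $q=\infty$. Then $\mathfrak u_{1,q}$ and $\mathfrak u_{\mathrm{res},p}$ are real Banach spaces, $a\rho\in L_{1,q}(\mathcal H)$ and $\mathrm{Tr_{res}}(a\rho)\in\mathbb R$ for all $a\in\mathfrak u_{\mathrm{res},p}$ and $\rho\in\mathfrak u_{1,q}$, and $\mathfrak u_{1,q}$ is a predual of $\mathfrak u_{\mathrm{res},p}$ through the pairing $(a,\rho)\mapsto\mathrm{Tr_{res}}(a\rho)$: the map $$\mathfrak u_{\mathrm{res},p}\to(\mathfrak u_{1,q})^*,\qquad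 a\mapsto\bigl(\rho\mapsto\mathrm{Tr_{res}}(a\rho)\bigr),$$ is well defined and is a topological isomorphism of real Banach spaces onto the continuous real dual of $\mathfrak u_{1,q}$. -/

import Mathlib

open scoped ENNReal InnerProductSpace

namespace SchattenRestricted

/-! ### Sets of vectors with a norm, as real normed spaces -/

section NormedSubset

variable {V : Type*} [AddCommGroup V] [Module ℝ V]

/-- `S` is a real linear subspace of `V`, and `N` restricts to a norm on `S`. -/
structure IsNormedSubspace (S : Set V) (N : V → ℝ) : Prop where
  zero_mem : (0 : V) ∈ S
  add_mem : ∀ {x y : V}, x ∈ S → y ∈ S → x + y ∈ S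
  smul_mem : ∀ (c : ℝ) {x : V}, x ∈ S → c • x ∈ S
  norm_nonneg : ∀ {x : V}, x ∈ S → 0 ≤ N x
  norm_smul : ∀ (c : ℝ) {x : V}, x ∈ S → N (c • x) = |c| * N x
  norm_add_le : ∀ {x y : V}, x ∈ S → y ∈ S → N (x + y) ≤ N x + N y
  eq_zero_of_norm : ∀ {x : V}, x ∈ S → N x = 0 → x = 0

namespace IsNormedSubspace

variable {S : Set V} {N : V → ℝ}

/-- The linear subspace with carrier `S`. -/
def toSubmodule (h : IsNormedSubspace S N) : Submodule ℝ V where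
  carrier := S
  zero_mem' := h.zero_mem
  add_mem' := h.add_mem
  smul_mem' := fun c _ hx => h.smul_mem c hx

/-- The subspace `S`, as a type which carries the norm `N`. -/
def Space (h : IsNormedSubspace S N) : Type _ := h.toSubmodule

/-- The element of `V` underlying an element of the normed space `S`. -/
def Space.val {h : IsNormedSubspace S N} (x : h.Space) : V := Subtype.val (p := (· ∈ S)) x

instance (h : IsNormedSubspace S N) : AddCommGroup h.Space :=
  inferInstanceAs (AddCommGroup h.toSubmodule)

instance (h : IsNormedSubspace S N) : Module ℝ h.Space :=
  inferInstanceAs (Module ℝ h.toSubmodule)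

instance (h : IsNormedSubspace S N) : Norm h.Space := ⟨fun x => N x.val⟩

theorem normedCore (h : IsNormedSubspace S N) : NormedSpace.Core ℝ h.Space where
  norm_nonneg x := h.norm_nonneg x.2
  norm_smul c x := h.norm_smul c x.2
  norm_triangle x y := h.norm_add_le x.2 y.2
  norm_eq_zero_iff x :=
    ⟨fun hx => Subtype.ext (h.eq_zero_of_norm x.2 hx), fun hx => by
      subst hx
      have h0 := h.norm_smul 0 h.zero_mem
      rw [smul_zero, abs_zero, zero_mul] at h0
      exact h0⟩

noncomputable instance (h : IsNormedSubspace S N) : NormedAddCommGroup h.Space :=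
  NormedAddCommGroup.ofCore h.normedCore

noncomputable instance (h : IsNormedSubspace S N) : NormedSpace ℝ h.Space :=
  NormedSpace.ofCore h.normedCore

end IsNormedSubspace

end NormedSubset

/-! ### Traces and Schatten classes -/

section Schatten

variable {E F : Type*}
  [NormedAddCommGroup E] [InnerProductSpace ℂ E] [CompleteSpace E]
  [NormedAddCommGroup F] [InnerProductSpace ℂ F] [CompleteSpace F]

variable (E) in
/-- The set of vectors of some orthonormal Hilbert basis of `E`. -/
noncomputable def basisSet : Set E := (exists_hilbertBasis ℂ E).choose

/-- The trace `∑ₑ ⟨e, T e⟩ ∈ [0, ∞]` of a positive bounded operator `T`, where `e` runs over an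
orthonormal Hilbert basis. -/
noncomputable def posTrace (T : E →L[ℂ] E) : ℝ≥0∞ :=
  ∑' e : basisSet E, ENNReal.ofReal (RCLike.re ⟪(e : E), T e⟫_ℂ)

/-- The trace `∑ₑ ⟨e, T e⟩` of a trace class operator `T`, where `e` runs over an
orthonormal Hilbert basis. -/
noncomputable def trace (T : E →L[ℂ] E) : ℂ :=
  ∑' e : basisSet E, ⟪(e : E), T e⟫_ℂ

/-- `Tr (A* A)^{p/2}`, for a finite exponent `p`. -/
noncomputable def schattenTrace (p : ℝ) (A : E →L[ℂ] F) : ℝ≥0∞ :=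
  posTrace ((ContinuousLinearMap.adjoint A ∘L A) ^ (p / 2))

/-- `A ∈ L_p(E, F)`: for `p < ∞` this means `Tr (A* A)^{p/2} < ∞`, and `L_∞` is the space of
compact operators. -/
def MemSchatten (p : ℝ≥0∞) (A : E →L[ℂ] F) : Prop :=
  if p = ∞ then IsCompactOperator A else schattenTrace p.toReal A < ∞

/-- The norm of `L_p(E, F)`: `(Tr (A* A)^{p/2})^{1/p}` for `p < ∞`, and the operator norm for
`p = ∞`. -/
noncomputable def schattenNorm (p : ℝ≥0∞) (A : E →L[ℂ] F) : ℝ :=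
  if p = ∞ then ‖A‖ else (schattenTrace p.toReal A).toReal ^ (1 / p.toReal)

end Schatten

/-! ### Restricted spaces of operators on a polarized Hilbert space

`Hp` is the closed subspace `H₊`, and `Hpᗮ` is `H₋`. -/

section Restricted

variable {H : Type*} [NormedAddCommGroup H] [InnerProductSpace ℂ H] [CompleteSpace H]

/-- The block `pr_L ∘ A|_K : K → L` of `A`. -/
noncomputable def block (L K : Submodule ℂ H) [L.HasOrthogonalProjection] (A : H →L[ℂ] H) :
    K →L[ℂ] L :=
  L.orthogonalProjectionOnto ∘L A ∘L K.subtypeL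

variable (Hp : Submodule ℂ H) [CompleteSpace Hp]

/-- `d = i (pr₊ - pr₋)`. -/
noncomputable def d : H →L[ℂ] H :=
  Complex.I • (Hp.starProjection - Hpᗮ.starProjection)

/-- The commutator `[d, A]`. -/
noncomputable def commD (A : H →L[ℂ] H) : H →L[ℂ] H := d Hp * A - A * d Hp

/-- `L_{1,q}(H)`. -/
def L1q (q : ℝ≥0∞) : Set (H →L[ℂ] H) :=
  {ρ | MemSchatten q (commD Hp ρ) ∧ MemSchatten 1 (block Hp Hp ρ) ∧
    MemSchatten 1 (block Hpᗮ Hpᗮ ρ)}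

/-- The norm `‖ρ₊₊‖₁ + ‖ρ₋₋‖₁ + ‖ρ₊₋‖_q + ‖ρ₋₊‖_q` of `L_{1,q}(H)`. -/
noncomputable def norm1q (q : ℝ≥0∞) (ρ : H →L[ℂ] H) : ℝ :=
  schattenNorm 1 (block Hp Hp ρ) + schattenNorm 1 (block Hpᗮ Hpᗮ ρ) +
    schattenNorm q (block Hp Hpᗮ ρ) + schattenNorm q (block Hpᗮ Hp ρ)

/-- `L_{res,p}(H)`. -/
def Lres (p : ℝ≥0∞) : Set (H →L[ℂ] H) := {A | MemSchatten p (commD Hp A)}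

/-- The norm `‖A‖ + ‖[d, A]‖_p` of `L_{res,p}(H)`. -/
noncomputable def normRes (p : ℝ≥0∞) (A : H →L[ℂ] H) : ℝ := ‖A‖ + schattenNorm p (commD Hp A)

variable (H) in
/-- The bounded skew-Hermitian operators `𝔲(H)`. -/
def skewHermitian : Set (H →L[ℂ] H) := {a | ContinuousLinearMap.adjoint a = -a}

/-- `𝔲_{1,q} = 𝔲(H) ∩ L_{1,q}(H)`. -/
def u1q (q : ℝ≥0∞) : Set (H →L[ℂ] H) := skewHermitian H ∩ L1q Hp q

/-- `𝔲_{res,p} = 𝔲(H) ∩ L_{res,p}(H)`. -/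
def uRes (p : ℝ≥0∞) : Set (H →L[ℂ] H) := skewHermitian H ∩ Lres Hp p

/-- The restricted trace `Tr ρ₊₊ + Tr ρ₋₋`. -/
noncomputable def trRes (ρ : H →L[ℂ] H) : ℂ :=
  trace (block Hp Hp ρ) + trace (block Hpᗮ Hpᗮ ρ)

end Restricted

end SchattenRestricted

/-! Blockwise, the restricted trace of `a ρ` is Tr(a₊₊ρ₊₊) + Tr(a₊₋ρ₋₊) + Tr(a₋₊ρ₊₋) + Tr(a₋₋ρ₋₋).
The diagonal blocks thus pair bounded with trace class operators and the off-diagonal ones pair L_p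
with L_q, so that the theorem combines the dualities L_1* = B and L_q* = L_p, with L_∞ the compact
operators. Hölder's inequality (`schattenENorm_comp_le_mul`) bounds the pairing.

Everything else is read off the operators z w* - w z*. Their real span is dense in 𝔲_{1,q}
(`exists_mem_span_skewRank`), and a skew-Hermitian `a` pairs with them to 2 Re⟨w, a z⟩
(`trRes_mul_skewRank`). Hence the pairing is real, and w = a z gives injectivity. Conversely, the
values of a functional φ on these operators are the real part of a bounded sesquilinear form, which
yields a skew-Hermitian operator; testing φ on M - M*, with M of finite rank from H₊ to H₋, puts its
block a₊₋ in L_p (`schattenENorm_block_representative_le`), and a₋₊ = -a₊₋*. The open mapping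
theorem then gives the topological isomorphism.

The Schatten norm is handled as the supremum of (∑ⱼ |⟨yⱼ, A xⱼ⟩|^p)^{1/p} over finite Bessel
families. In this form the triangle inequality, the ideal property, monotonicity in p and lower
semicontinuity are short. For compact A it agrees with the trace definition
(`schattenTrace_eq_schattenSup`): eigenvectors of A*A diagonalize A, and Jensen's inequality for
doubly substochastic matrices shows that no Bessel family does better than this basis. For p ≤ 2 a
finite supremum forces compactness, by comparison with the Hilbert-Schmidt norm. -/

set_option linter.unusedSectionVars false

namespace SchattenRestricted

/-! ### Inequalities for sums in `[0, ∞]` -/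

section Sums

variable {ι κ : Type*}

theorem tsum_mul_le_Lp_mul_Lq {p q : ℝ} (hpq : p.HolderConjugate q) (f g : ι → ℝ≥0∞) :
    ∑' i, f i * g i ≤ (∑' i, f i ^ p) ^ (1 / p) * (∑' i, g i ^ q) ^ (1 / q) := by
  rw [ENNReal.tsum_eq_iSup_sum]
  refine iSup_le fun s => (ENNReal.inner_le_Lp_mul_Lq s f g hpq).trans ?_
  have h1 := hpq.pos
  have h2 := hpq.symm.pos
  gcongr <;> exact ENNReal.sum_le_tsum s

theorem tsum_mul_le_sqrt_mul_sqrt (f g : ι → ℝ≥0∞) :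
    ∑' i, f i * g i ≤ (∑' i, f i ^ 2) ^ (1 / 2 : ℝ) * (∑' i, g i ^ 2) ^ (1 / 2 : ℝ) := by
  have h := tsum_mul_le_Lp_mul_Lq Real.HolderConjugate.two_two f g
  simpa using h

/-- Convexity of t ↦ t^p; weights of total mass below one only help, through the factor (∑ w)^(1 -
1/p) ≤ 1. -/
theorem rpow_tsum_mul_le {p : ℝ} (hp : 1 ≤ p) (w s : ι → ℝ≥0∞) (hw : ∑' i, w i ≤ 1) :
    (∑' i, w i * s i) ^ p ≤ ∑' i, w i * s i ^ p := by
  have hp0 : 0 < p := one_pos.trans_le hp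
  rw [← ENNReal.le_rpow_inv_iff hp0, ENNReal.tsum_eq_iSup_sum]
  refine iSup_le fun t => (ENNReal.inner_le_weight_mul_Lp_of_nonneg t hp w s).trans ?_
  have h1 : (∑ i ∈ t, w i) ^ (1 - p⁻¹) ≤ 1 :=
    ENNReal.rpow_le_one ((ENNReal.sum_le_tsum t).trans hw) (by
      rw [sub_nonneg]; exact inv_le_one_of_one_le₀ hp)
  calc _ ≤ 1 * (∑ i ∈ t, w i * s i ^ p) ^ p⁻¹ := by gcongr
    _ ≤ _ := by
      rw [one_mul]
      gcongr
      exact ENNReal.sum_le_tsum t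

/-- Jensen's inequality for a doubly substochastic matrix. -/
theorem tsum_rpow_tsum_mul_le {p : ℝ} (hp : 1 ≤ p) (w : ι → κ → ℝ≥0∞) (s : κ → ℝ≥0∞)
    (h1 : ∀ i, ∑' k, w i k ≤ 1) (h2 : ∀ k, ∑' i, w i k ≤ 1) :
    ∑' i, (∑' k, w i k * s k) ^ p ≤ ∑' k, s k ^ p := by
  calc _ ≤ ∑' i, ∑' k, w i k * s k ^ p :=
        ENNReal.tsum_le_tsum fun i => rpow_tsum_mul_le hp _ _ (h1 i)
    _ = ∑' k, (∑' i, w i k) * s k ^ p := by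
        rw [ENNReal.tsum_comm]
        simp_rw [ENNReal.tsum_mul_right]
    _ ≤ ∑' k, s k ^ p := ENNReal.tsum_le_tsum fun k => mul_le_of_le_one_left' (h2 k)

/-- Every term is at most the ℓ^p norm M, so f^q ≤ M^(q-p) f^p, and summing gives M^q. -/
theorem sum_rpow_rpow_le {p q : ℝ} (hp : 0 < p) (hpq : p ≤ q) (s : Finset ι) (f : ι → ℝ≥0∞) :
    (∑ i ∈ s, f i ^ q) ^ (1 / q) ≤ (∑ i ∈ s, f i ^ p) ^ (1 / p) := by
  have hq : 0 < q := hp.trans_le hpq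
  set M := (∑ i ∈ s, f i ^ p) ^ (1 / p) with hM
  have hMp : M ^ p = ∑ i ∈ s, f i ^ p := by
    rw [hM, ← ENNReal.rpow_mul, one_div_mul_cancel hp.ne', ENNReal.rpow_one]
  have hf : ∀ i ∈ s, f i ≤ M := fun i hi => by
    rw [hM, one_div, ENNReal.le_rpow_inv_iff hp]
    exact Finset.single_le_sum (f := fun i => f i ^ p) (fun _ _ => zero_le) hi
  rw [one_div, ENNReal.rpow_inv_le_iff hq]
  calc ∑ i ∈ s, f i ^ q = ∑ i ∈ s, f i ^ (q - p) * f i ^ p := by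
        refine Finset.sum_congr rfl fun i _ => ?_
        rw [← ENNReal.rpow_add_of_nonneg _ _ (sub_nonneg.2 hpq) hp.le, sub_add_cancel]
    _ ≤ ∑ i ∈ s, M ^ (q - p) * f i ^ p := by
        refine Finset.sum_le_sum fun i hi => ?_
        have := sub_nonneg.2 hpq
        gcongr
        exact hf i hi
    _ = M ^ q := by
        rw [← Finset.mul_sum, ← hMp, ← ENNReal.rpow_add_of_nonneg _ _ (sub_nonneg.2 hpq) hp.le,
          sub_add_cancel]

end Sums

/-! ### Bessel families -/

section Bessel

variable {E F : Type*}
  [NormedAddCommGroup E] [InnerProductSpace ℂ E]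
  [NormedAddCommGroup F] [InnerProductSpace ℂ F]

/-- A family of vectors which satisfies Bessel's inequality. -/
def IsBessel {ι : Type*} (x : ι → E) : Prop := ∀ u, ∑' i, ‖⟪x i, u⟫_ℂ‖ₑ ^ 2 ≤ ‖u‖ₑ ^ 2

theorem enorm_inner_le (x y : E) : ‖⟪x, y⟫_ℂ‖ₑ ≤ ‖x‖ₑ * ‖y‖ₑ := by
  rw [← ofReal_norm, ← ofReal_norm, ← ofReal_norm, ← ENNReal.ofReal_mul (norm_nonneg _)]
  exact ENNReal.ofReal_le_ofReal (norm_inner_le_norm _ _)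

theorem enorm_inner_self (x : E) : ‖⟪x, x⟫_ℂ‖ₑ = ‖x‖ₑ ^ 2 := by
  rw [inner_self_eq_norm_sq_to_K, ← ofReal_norm, ← ofReal_norm, ← ENNReal.ofReal_pow (norm_nonneg _)]
  simp

theorem enorm_inner_comm (x y : E) : ‖⟪x, y⟫_ℂ‖ₑ = ‖⟪y, x⟫_ℂ‖ₑ := by
  rw [← ofReal_norm, norm_inner_symm, ofReal_norm]

namespace IsBessel

variable {ι κ : Type*} {x : ι → E} {y : ι → F}

theorem comp_injective (hx : IsBessel x) {f : κ → ι} (hf : Function.Injective f) :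
    IsBessel (x ∘ f) := fun u =>
  (ENNReal.tsum_comp_le_tsum_of_injective hf fun i => ‖⟪x i, u⟫_ℂ‖ₑ ^ 2).trans (hx u)

/-- Bessel's inequality tested on `x i` itself gives ‖xᵢ‖⁴ ≤ ‖xᵢ‖². -/
theorem enorm_le_one (hx : IsBessel x) (i : ι) : ‖x i‖ₑ ≤ 1 := by
  have h := (ENNReal.le_tsum i).trans (hx (x i))
  rw [enorm_inner_self] at h
  by_contra! hlt
  have hfin : ‖x i‖ₑ ^ 2 ≠ ∞ := by finiteness
  have h0 : ‖x i‖ₑ ^ 2 ≠ 0 := by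
    have : ‖x i‖ₑ ≠ 0 := (zero_lt_one.trans hlt).ne'
    positivity
  have h3 : ‖x i‖ₑ ^ 2 * ‖x i‖ₑ ^ 2 ≤ ‖x i‖ₑ ^ 2 * 1 := by rw [mul_one, ← sq]; exact h
  rw [ENNReal.mul_le_mul_iff_right h0 hfin] at h3
  exact absurd h3 (not_le.2 (one_lt_pow₀ hlt two_ne_zero))

theorem tsum_mul_le (hx : IsBessel x) (hy : IsBessel y) (u : E) (v : F) :
    ∑' i, ‖⟪x i, u⟫_ℂ‖ₑ * ‖⟪y i, v⟫_ℂ‖ₑ ≤ ‖u‖ₑ * ‖v‖ₑ := by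
  refine (tsum_mul_le_sqrt_mul_sqrt _ _).trans ?_
  have key (a : ℝ≥0∞) : (a ^ 2) ^ (1 / 2 : ℝ) = a := by
    rw [← ENNReal.rpow_natCast, ← ENNReal.rpow_mul]; norm_num
  conv_rhs => rw [← key ‖u‖ₑ, ← key ‖v‖ₑ]
  gcongr
  · exact hx u
  · exact hy v

/-- This bounds the row and column sums of the matrices |⟨xᵢ, u⟩| |⟨yᵢ, v⟩| that are fed to
`tsum_rpow_tsum_mul_le`. -/
theorem tsum_mul_le_one (hx : IsBessel x) (hy : IsBessel y) {u : E} {v : F}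
    (hu : ‖u‖ₑ ≤ 1) (hv : ‖v‖ₑ ≤ 1) : ∑' i, ‖⟪x i, u⟫_ℂ‖ₑ * ‖⟪y i, v⟫_ℂ‖ₑ ≤ 1 :=
  (hx.tsum_mul_le hy u v).trans (mul_le_one' hu hv)

/-- Stability under contractions is the reason to use Bessel families instead of orthonormal ones.
-/
theorem map [CompleteSpace E] [CompleteSpace F] (hx : IsBessel x) {B : E →L[ℂ] F}
    (hB : ‖B‖ₑ ≤ 1) : IsBessel fun i => B (x i) := fun u => by
  have h (i) : ⟪B (x i), u⟫_ℂ = ⟪x i, B.adjoint u⟫_ℂ :=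
    (ContinuousLinearMap.adjoint_inner_right B (x i) u).symm
  simp_rw [h]
  refine (hx _).trans ?_
  have hB' : ‖B.adjoint‖ₑ ≤ 1 := by
    rwa [← ofReal_norm, LinearIsometryEquiv.norm_map, ofReal_norm]
  have : ‖B.adjoint u‖ₑ ≤ ‖u‖ₑ :=
    (B.adjoint.le_opENorm u).trans (mul_le_of_le_one_left' hB')
  gcongr

theorem smul (hx : IsBessel x) {c : ι → ℂ} (hc : ∀ i, ‖c i‖ₑ ≤ 1) :
    IsBessel fun i => c i • x i := fun u => by
  refine (ENNReal.tsum_le_tsum fun i => ?_).trans (hx u)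
  rw [inner_smul_left, enorm_mul, RCLike.enorm_conj]
  gcongr
  exact mul_le_of_le_one_left' (hc i)

end IsBessel

theorem _root_.Orthonormal.isBessel {ι : Type*} {x : ι → E} (hx : Orthonormal ℂ x) :
    IsBessel x := fun u => by
  rw [ENNReal.tsum_eq_iSup_sum]
  refine iSup_le fun s => ?_
  have h := hx.sum_inner_products_le u (s := s)
  have h2 := ENNReal.ofReal_le_ofReal h
  rw [ENNReal.ofReal_sum_of_nonneg (fun _ _ => by positivity)] at h2
  simpa [ENNReal.ofReal_pow] using h2

theorem isBessel_const {x : E} (hx : ‖x‖ₑ ≤ 1) : IsBessel fun _ : Fin 1 => x := fun u => by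
  simp only [tsum_fintype, Finset.univ_unique, Finset.sum_const, Finset.card_singleton, one_smul]
  gcongr
  exact (enorm_inner_le x u).trans (mul_le_of_le_one_left' hx)

theorem _root_.HilbertBasis.tsum_enorm_inner_sq {ι : Type*} (b : HilbertBasis ι ℂ E) (x : E) :
    ∑' i, ‖⟪b i, x⟫_ℂ‖ₑ ^ 2 = ‖x‖ₑ ^ 2 := by
  refine le_antisymm (b.orthonormal.isBessel x) ?_
  rw [← enorm_inner_self, ← b.tsum_inner_mul_inner]
  refine enorm_tsum_le_tsum_enorm.trans (ENNReal.tsum_le_tsum fun i => ?_)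
  rw [enorm_mul, enorm_inner_comm x, sq]

end Bessel

/-! ### Schatten norms as suprema over Bessel families -/

section SchattenSup

variable {E F G : Type*}
  [NormedAddCommGroup E] [InnerProductSpace ℂ E] [CompleteSpace E]
  [NormedAddCommGroup F] [InnerProductSpace ℂ F] [CompleteSpace F]
  [NormedAddCommGroup G] [InnerProductSpace ℂ G] [CompleteSpace G]

/-- The supremum of `∑ⱼ |⟨yⱼ, A xⱼ⟩| ^ p` over finite Bessel families `x`, `y`. -/
noncomputable def schattenSup (p : ℝ) (A : E →L[ℂ] F) : ℝ≥0∞ :=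
  ⨆ (n : ℕ) (x : Fin n → E) (y : Fin n → F) (_ : IsBessel x) (_ : IsBessel y),
    ∑ j, ‖⟪y j, A (x j)⟫_ℂ‖ₑ ^ p

theorem schattenSup_le_iff {p : ℝ} {A : E →L[ℂ] F} {C : ℝ≥0∞} :
    schattenSup p A ≤ C ↔ ∀ (n : ℕ) (x : Fin n → E) (y : Fin n → F), IsBessel x → IsBessel y →
      ∑ j, ‖⟪y j, A (x j)⟫_ℂ‖ₑ ^ p ≤ C := by
  simp only [schattenSup, iSup_le_iff]

/-- Finite subfamilies of a Bessel family are Bessel, so arbitrary index sets, such as those of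
Hilbert bases, may be used. -/
theorem tsum_le_schattenSup {ι : Type*} (p : ℝ) (A : E →L[ℂ] F) {x : ι → E} {y : ι → F}
    (hx : IsBessel x) (hy : IsBessel y) :
    ∑' j, ‖⟪y j, A (x j)⟫_ℂ‖ₑ ^ p ≤ schattenSup p A := by
  rw [ENNReal.tsum_eq_iSup_sum]
  refine iSup_le fun s => ?_
  have hf : Function.Injective fun k : Fin s.card => ((s.equivFin.symm k : s) : ι) :=
    Subtype.val_injective.comp s.equivFin.symm.injective
  have h := schattenSup_le_iff.1 (le_refl (schattenSup p A)) s.card _ _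
    (hx.comp_injective hf) (hy.comp_injective hf)
  refine le_trans (le_of_eq ?_) h
  rw [← Finset.sum_coe_sort s]
  exact (Equiv.sum_comp s.equivFin.symm fun i : s => ‖⟪y i, A (x i)⟫_ℂ‖ₑ ^ p).symm

theorem schattenSup_adjoint_le (p : ℝ) (A : E →L[ℂ] F) :
    schattenSup p A.adjoint ≤ schattenSup p A := by
  refine schattenSup_le_iff.2 fun n x y hx hy => ?_
  have h := tsum_le_schattenSup p A hy hx
  rw [tsum_fintype] at h
  simpa only [ContinuousLinearMap.adjoint_inner_right, enorm_inner_comm] using h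

theorem schattenSup_comp_le_of_contraction (p : ℝ) (A : E →L[ℂ] F) {B : F →L[ℂ] G}
    (hB : ‖B‖ₑ ≤ 1) : schattenSup p (B ∘L A) ≤ schattenSup p A := by
  refine schattenSup_le_iff.2 fun n x y hx hy => ?_
  have hB' : ‖B.adjoint‖ₑ ≤ 1 := by
    rwa [← ofReal_norm, LinearIsometryEquiv.norm_map, ofReal_norm]
  have h := tsum_le_schattenSup p A hx (hy.map hB')
  rw [tsum_fintype] at h
  simpa only [ContinuousLinearMap.adjoint_inner_left, ContinuousLinearMap.comp_apply] using h

/-- A supremum of functions continuous in the operator is lower semicontinuous; completeness of both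
spaces rests on this. -/
theorem schattenSup_le_of_tendsto {p : ℝ} {A : ℕ → E →L[ℂ] F} {B : E →L[ℂ] F}
    (h : Filter.Tendsto A Filter.atTop (nhds B)) {C : ℝ≥0∞}
    (hC : ∀ᶠ n in Filter.atTop, schattenSup p (A n) ≤ C) : schattenSup p B ≤ C := by
  refine schattenSup_le_iff.2 fun n x y hx hy => ?_
  have hc : Continuous fun T : E →L[ℂ] F => ∑ j, ‖⟪y j, T (x j)⟫_ℂ‖ₑ ^ p := by
    refine continuous_finsetSum _ fun j _ => ?_
    refine (ENNReal.continuous_rpow_const).comp (continuous_enorm.comp ?_)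
    fun_prop
  exact le_of_tendsto (hc.continuousAt.tendsto.comp h)
    (hC.mono fun m hm => schattenSup_le_iff.1 hm n x y hx hy)

theorem schattenSup_smul (p : ℝ) (hp : 0 ≤ p) (c : ℂ) (A : E →L[ℂ] F) :
    schattenSup p (c • A) = ‖c‖ₑ ^ p * schattenSup p A := by
  simp only [schattenSup, ENNReal.mul_iSup, Finset.mul_sum, smul_apply,
    inner_smul_right, enorm_mul, ENNReal.mul_rpow_of_nonneg _ _ hp]

/-- The Schatten norm with values in `[0, ∞]`. -/
noncomputable def schattenENorm (p : ℝ≥0∞) (A : E →L[ℂ] F) : ℝ≥0∞ :=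
  if p = ∞ then ‖A‖ₑ else schattenSup p.toReal A ^ (1 / p.toReal)

variable {p q : ℝ≥0∞}

theorem schattenENorm_top (A : E →L[ℂ] F) : schattenENorm ∞ A = ‖A‖ₑ := if_pos rfl

theorem schattenENorm_of_ne_top (hp : p ≠ ∞) (A : E →L[ℂ] F) :
    schattenENorm p A = schattenSup p.toReal A ^ (1 / p.toReal) := if_neg hp

theorem schattenENorm_one (A : E →L[ℂ] F) : schattenENorm 1 A = schattenSup 1 A := by
  simp [schattenENorm]

theorem one_le_toReal (hp : 1 ≤ p) (hp' : p ≠ ∞) : 1 ≤ p.toReal := by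
  rw [← ENNReal.toReal_one]
  exact ENNReal.toReal_mono hp' hp

theorem toReal_pos_of_one_le (hp : 1 ≤ p) (hp' : p ≠ ∞) : 0 < p.toReal :=
  one_pos.trans_le (one_le_toReal hp hp')

theorem schattenENorm_le_iff (hp : 1 ≤ p) (hp' : p ≠ ∞) {A : E →L[ℂ] F} {C : ℝ≥0∞} :
    schattenENorm p A ≤ C ↔ schattenSup p.toReal A ≤ C ^ p.toReal := by
  rw [schattenENorm_of_ne_top hp', one_div, ENNReal.rpow_inv_le_iff (toReal_pos_of_one_le hp hp')]

theorem schattenENorm_add_le (hp : 1 ≤ p) (A B : E →L[ℂ] F) :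
    schattenENorm p (A + B) ≤ schattenENorm p A + schattenENorm p B := by
  by_cases hp' : p = ∞
  · subst hp'
    simpa only [schattenENorm_top] using enorm_add_le A B
  have h1 := one_le_toReal hp hp'
  have h0 := toReal_pos_of_one_le hp hp'
  refine (schattenENorm_le_iff hp hp').2 (schattenSup_le_iff.2 fun n x y hx hy => ?_)
  rw [← ENNReal.rpow_inv_le_iff h0, ← one_div]
  calc _ ≤ (∑ j, (‖⟪y j, A (x j)⟫_ℂ‖ₑ + ‖⟪y j, B (x j)⟫_ℂ‖ₑ) ^ p.toReal) ^ (1 / p.toReal) := by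
        gcongr with j
        rw [add_apply, inner_add_right]
        exact enorm_add_le _ _
    _ ≤ _ := ENNReal.Lp_add_le _ _ _ h1
    _ ≤ _ := by
        rw [schattenENorm_of_ne_top hp', schattenENorm_of_ne_top hp']
        gcongr <;> rw [← tsum_fintype (L := .unconditional _)] <;>
          exact tsum_le_schattenSup _ _ hx hy

theorem schattenENorm_smul (hp : 1 ≤ p) (c : ℂ) (A : E →L[ℂ] F) :
    schattenENorm p (c • A) = ‖c‖ₑ * schattenENorm p A := by
  by_cases hp' : p = ∞
  · subst hp'
    simp only [schattenENorm_top, enorm_smul]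
  have h0 := toReal_pos_of_one_le hp hp'
  rw [schattenENorm_of_ne_top hp', schattenENorm_of_ne_top hp', schattenSup_smul _ h0.le,
    ENNReal.mul_rpow_of_nonneg _ _ (by positivity), ← ENNReal.rpow_mul, mul_one_div_cancel h0.ne',
    ENNReal.rpow_one]

theorem schattenENorm_zero (hp : 1 ≤ p) : schattenENorm p (0 : E →L[ℂ] F) = 0 := by
  simpa using schattenENorm_smul hp 0 (0 : E →L[ℂ] F)

theorem schattenENorm_neg (hp : 1 ≤ p) (A : E →L[ℂ] F) :
    schattenENorm p (-A) = schattenENorm p A := by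
  simpa using schattenENorm_smul hp (-1) A

theorem schattenENorm_sub_le (hp : 1 ≤ p) (A B : E →L[ℂ] F) :
    schattenENorm p (A - B) ≤ schattenENorm p A + schattenENorm p B := by
  rw [sub_eq_add_neg, ← schattenENorm_neg hp B]
  exact schattenENorm_add_le hp _ _

theorem schattenENorm_adjoint_le (hp : 1 ≤ p) (A : E →L[ℂ] F) :
    schattenENorm p A.adjoint ≤ schattenENorm p A := by
  by_cases hp' : p = ∞
  · subst hp'
    rw [schattenENorm_top, schattenENorm_top, ← ofReal_norm, LinearIsometryEquiv.norm_map,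
      ofReal_norm]
  rw [schattenENorm_of_ne_top hp', schattenENorm_of_ne_top hp']
  gcongr
  exact schattenSup_adjoint_le _ _

theorem schattenENorm_adjoint (hp : 1 ≤ p) (A : E →L[ℂ] F) :
    schattenENorm p A.adjoint = schattenENorm p A :=
  (schattenENorm_adjoint_le hp A).antisymm (by
    simpa using schattenENorm_adjoint_le hp A.adjoint)

theorem schattenENorm_comp_le (hp : 1 ≤ p) (B : F →L[ℂ] G) (A : E →L[ℂ] F) :
    schattenENorm p (B ∘L A) ≤ ‖B‖ₑ * schattenENorm p A := by
  by_cases hp' : p = ∞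
  · subst hp'
    simp only [schattenENorm_top]
    exact ContinuousLinearMap.opENorm_comp_le B A
  by_cases hB : B = 0
  · simp [hB, schattenENorm_zero hp]
  have hB' : B = (‖B‖ : ℂ) • ((‖B‖ : ℂ)⁻¹ • B) := by
    rw [smul_inv_smul₀]; simpa using hB
  have hn : ‖(‖B‖ : ℂ)⁻¹ • B‖ₑ ≤ 1 := by
    rw [← ofReal_norm, norm_smul, norm_inv, Complex.norm_real, norm_norm,
      inv_mul_cancel₀ (norm_ne_zero_iff.2 hB), ENNReal.ofReal_one]
  conv_lhs => rw [hB']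
  rw [ContinuousLinearMap.smul_comp, schattenENorm_smul hp]
  have : ‖(‖B‖ : ℂ)‖ₑ = ‖B‖ₑ := by
    rw [← ofReal_norm, Complex.norm_real, norm_norm, ofReal_norm]
  rw [this]
  gcongr
  rw [schattenENorm_of_ne_top hp', schattenENorm_of_ne_top hp']
  gcongr
  exact schattenSup_comp_le_of_contraction _ _ hn

theorem schattenENorm_comp_le' (hp : 1 ≤ p) (A : F →L[ℂ] G) (B : E →L[ℂ] F) :
    schattenENorm p (A ∘L B) ≤ schattenENorm p A * ‖B‖ₑ := by
  rw [← schattenENorm_adjoint hp, ContinuousLinearMap.adjoint_comp, mul_comm]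
  refine (schattenENorm_comp_le hp _ _).trans (le_of_eq ?_)
  rw [schattenENorm_adjoint hp, ← ofReal_norm, LinearIsometryEquiv.norm_map, ofReal_norm]

theorem enorm_normalize_le (v : E) : ‖((‖v‖ : ℂ)⁻¹) • v‖ₑ ≤ 1 := by
  rw [← ofReal_norm, norm_smul, norm_inv, Complex.norm_real, norm_norm]
  exact ENNReal.ofReal_le_one.2 inv_mul_le_one

/-- Families with a single vector suffice: x/‖x‖ and Ax/‖Ax‖ give the value ‖Ax‖/‖x‖. -/
theorem enorm_le_schattenENorm (hp : 1 ≤ p) (A : E →L[ℂ] F) : ‖A‖ₑ ≤ schattenENorm p A := by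
  by_cases hp' : p = ∞
  · subst hp'
    rw [schattenENorm_top]
  have h0 := toReal_pos_of_one_le hp hp'
  have hunit (x : E) (y : F) (hx : ‖x‖ₑ ≤ 1) (hy : ‖y‖ₑ ≤ 1) :
      ‖⟪y, A x⟫_ℂ‖ₑ ≤ schattenENorm p A := by
    rw [schattenENorm_of_ne_top hp', one_div, ENNReal.le_rpow_inv_iff h0]
    simpa using tsum_le_schattenSup p.toReal A (isBessel_const hx) (isBessel_const hy)
  by_cases htop : schattenENorm p A = ∞
  · rw [htop]; exact le_top
  have hle : ‖A‖ ≤ (schattenENorm p A).toReal := by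
    refine A.opNorm_le_bound ENNReal.toReal_nonneg fun x => ?_
    by_cases hx : x = 0
    · simp [hx]
    by_cases hy : A x = 0
    · simp only [hy, norm_zero]; positivity
    have h := hunit _ _ (enorm_normalize_le x) (enorm_normalize_le (A x))
    have h2 := ENNReal.toReal_mono htop h
    rw [toReal_enorm, map_smul, inner_smul_left, inner_smul_right, inner_self_eq_norm_sq_to_K] at h2
    have hx' : 0 < ‖x‖ := norm_pos_iff.2 hx
    have hy' : 0 < ‖A x‖ := norm_pos_iff.2 hy
    simp only [norm_mul, RCLike.norm_conj, norm_inv, Complex.norm_real, norm_norm, norm_pow,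
      Complex.coe_algebraMap] at h2
    rw [← div_le_iff₀ hx']
    refine le_trans (le_of_eq ?_) h2
    field_simp
  rw [← ofReal_norm]
  exact ENNReal.ofReal_le_of_le_toReal hle

theorem schattenENorm_anti (hp : 1 ≤ p) (hpq : p ≤ q) (A : E →L[ℂ] F) :
    schattenENorm q A ≤ schattenENorm p A := by
  by_cases hq' : q = ∞
  · subst hq'
    rw [schattenENorm_top]
    exact enorm_le_schattenENorm hp A
  have hp' : p ≠ ∞ := ne_top_of_le_ne_top hq' hpq
  have h0 := toReal_pos_of_one_le (hp.trans hpq) hq'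
  refine (schattenENorm_le_iff (hp.trans hpq) hq').2 (schattenSup_le_iff.2 fun n x y hx hy => ?_)
  rw [← ENNReal.rpow_inv_le_iff h0, ← one_div]
  refine (sum_rpow_rpow_le (toReal_pos_of_one_le hp hp') (ENNReal.toReal_mono hq' hpq) _ _).trans ?_
  rw [schattenENorm_of_ne_top hp']
  gcongr
  rw [← tsum_fintype (L := .unconditional _)]
  exact tsum_le_schattenSup _ _ hx hy

theorem schattenENorm_le_of_tendsto (hp : 1 ≤ p) {A : ℕ → E →L[ℂ] F} {B : E →L[ℂ] F}
    (h : Filter.Tendsto A Filter.atTop (nhds B)) {C : ℝ≥0∞}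
    (hC : ∀ᶠ n in Filter.atTop, schattenENorm p (A n) ≤ C) : schattenENorm p B ≤ C := by
  by_cases hp' : p = ∞
  · subst hp'
    simp only [schattenENorm_top] at hC ⊢
    exact le_of_tendsto (continuous_enorm.continuousAt.tendsto.comp h) hC
  rw [schattenENorm_le_iff hp hp']
  exact schattenSup_le_of_tendsto h
    (hC.mono fun n hn => (schattenENorm_le_iff hp hp').1 hn)

end SchattenSup

/-! ### Compact operators and diagonalization -/

section Compact

open InnerProductSpace

variable {E F G : Type*}
  [NormedAddCommGroup E] [InnerProductSpace ℂ E] [CompleteSpace E]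
  [NormedAddCommGroup F] [InnerProductSpace ℂ F] [CompleteSpace F]
  [NormedAddCommGroup G] [InnerProductSpace ℂ G] [CompleteSpace G]

theorem isCompactOperator_iff_totallyBounded {B : E →L[ℂ] F} :
    IsCompactOperator B ↔ TotallyBounded (B '' Metric.closedBall 0 1) := by
  refine (isCompactOperator_iff_isCompact_closure_image_closedBall (B : E →ₗ[ℂ] F) one_pos).trans ?_
  rw [isCompact_iff_totallyBounded_isComplete]
  exact ⟨fun h => h.1.subset subset_closure, fun h => ⟨h.closure, isClosed_closure.isComplete⟩⟩

/-- Since ‖Bv‖² ≤ ‖B*Bv‖ ‖v‖, a finite net for the image of the unit ball under B*B yields one for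
the image under B. -/
theorem isCompactOperator_of_adjoint_comp_self {B : E →L[ℂ] F}
    (h : IsCompactOperator (B.adjoint ∘L B)) : IsCompactOperator B := by
  rw [isCompactOperator_iff_totallyBounded] at h ⊢
  rw [Metric.totallyBounded_iff]
  intro ε hε
  -- Differences of points of the unit ball have norm at most 2, so ε²/2 for B*B becomes ε for B.
  obtain ⟨t, hts, htf, ht⟩ := totallyBounded_iff_subset.1 h _
    (Metric.dist_mem_uniformity (show 0 < ε ^ 2 / 2 by positivity))
  -- One preimage in the unit ball is chosen for each point of the net.
  obtain ⟨u, hu, huf, rfl⟩ : ∃ u ⊆ Metric.closedBall (0 : E) 1, u.Finite ∧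
      (B.adjoint ∘L B) '' u = t := by
    obtain ⟨u, hu, hut⟩ := Set.exists_subset_bijOn (Metric.closedBall (0 : E) 1 ∩
      (B.adjoint ∘L B) ⁻¹' t) (B.adjoint ∘L B)
    refine ⟨u, fun x hx => (hu hx).1, ?_, ?_⟩
    · refine Set.Finite.of_finite_image (htf.subset ?_) hut.injOn
      rintro _ ⟨x, hx, rfl⟩
      exact (hu hx).2
    · rw [hut.image_eq]
      ext y
      constructor
      · rintro ⟨x, hx, rfl⟩; exact hx.2
      · intro hy
        obtain ⟨x, hx, rfl⟩ := hts hy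
        exact ⟨x, ⟨hx, hy⟩, rfl⟩
  refine ⟨B '' u, huf.image _, ?_⟩
  rintro _ ⟨x, hx, rfl⟩
  have hx1 := ht ⟨x, hx, rfl⟩
  simp only [Set.mem_iUnion, exists_prop, Set.mem_image] at hx1 ⊢
  obtain ⟨_, ⟨z, hz, rfl⟩, hxz⟩ := hx1
  refine ⟨_, ⟨z, hz, rfl⟩, ?_⟩
  have hxz' : ‖(B.adjoint ∘L B) (x - z)‖ < ε ^ 2 / 2 := by
    rw [map_sub, ← dist_eq_norm]; exact hxz
  have hn : ‖x - z‖ ≤ 2 := by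
    have h1 := mem_closedBall_zero_iff.1 hx
    have h2 := mem_closedBall_zero_iff.1 (hu hz)
    linarith [norm_sub_le x z]
  have key : ‖B (x - z)‖ ^ 2 ≤ ‖(B.adjoint ∘L B) (x - z)‖ * ‖x - z‖ := by
    rw [ContinuousLinearMap.apply_norm_sq_eq_inner_adjoint_left]
    exact (RCLike.re_le_norm _).trans (norm_inner_le_norm _ _)
  rw [Metric.mem_ball, dist_eq_norm, ← map_sub]
  refine lt_of_pow_lt_pow_left₀ 2 hε.le (key.trans_lt ?_)
  nlinarith [norm_nonneg (x - z), norm_nonneg ((B.adjoint ∘L B) (x - z))]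

/-- `A` is diagonal with respect to `b`: the vectors `A bᵢ` are pairwise orthogonal. -/
def IsDiagonalizing {ι : Type*} (A : E →L[ℂ] F) (b : HilbertBasis ι ℂ E) : Prop :=
  Pairwise fun i j => ⟪A (b i), A (b j)⟫_ℂ = 0

/-- An orthonormal basis of eigenvectors of the compact self-adjoint operator A*A works, because ⟨A
bᵢ, A bⱼ⟩ = ⟨bᵢ, A*A bⱼ⟩. -/
theorem exists_isDiagonalizing {A : E →L[ℂ] F} (hA : IsCompactOperator A) :
    ∃ (s : Set E) (b : HilbertBasis s ℂ E), IsDiagonalizing A b := by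
  set T := A.adjoint ∘L A with hT
  have hTc : IsCompactOperator T := by
    rw [hT, ContinuousLinearMap.coe_comp]
    exact hA.clm_comp A.adjoint
  have hTs : (T : E →ₗ[ℂ] E).IsSymmetric :=
    (ContinuousLinearMap.isPositive_adjoint_comp_self A).isSymmetric
  have hbot := ContinuousLinearMap.orthogonalComplement_iSup_eigenspaces_eq_bot hTc hTs
  -- Eigenspaces are closed, so each has a Hilbert basis; the kernel may be infinite-dimensional.
  have hc (μ : ℂ) : CompleteSpace (Module.End.eigenspace (T : Module.End ℂ E) μ) := by
    refine IsClosed.completeSpace_coe (hs := ?_)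
    have : (Module.End.eigenspace (T : Module.End ℂ E) μ : Set E) = {x | T x = μ • x} := by
      ext x; simp
    rw [this]
    exact isClosed_eq T.continuous (continuous_const_smul μ)
  choose w b hb using fun μ : ℂ => exists_hilbertBasis ℂ (Module.End.eigenspace (T : Module.End ℂ E) μ)
  have hon := (hTs.orthogonalFamily_eigenspaces).orthonormal_sigma_orthonormal
    (v_family := fun μ => b μ) (fun μ => (b μ).orthonormal)
  set v : (Σ μ : ℂ, w μ) → E := fun a => ((b a.1 a.2 : Module.End.eigenspace (T : Module.End ℂ E) a.1) : E) with hv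
  have hon' : Orthonormal ℂ v := hon
  have hinj : Function.Injective v := hon'.linearIndependent.injective
  -- A vector orthogonal to all chosen eigenvectors is orthogonal to each eigenspace, by expansion
  -- in its basis, hence zero by the spectral theorem.
  have hsp : (Submodule.span ℂ (Set.range ((↑) : Set.range v → E)))ᗮ = ⊥ := by
    rw [Subtype.range_coe, eq_bot_iff, ← hbot]
    intro x hx
    rw [Submodule.mem_orthogonal] at hx ⊢
    intro u hu
    induction hu using Submodule.iSup_induction' with
    | mem μ y hy =>
      have h := (b μ).hasSum_repr ⟨y, hy⟩
      have h2 := (h.mapL (Submodule.subtypeL _)).mapL ((innerSL ℂ x))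
      have h0 : ∀ i, (innerSL ℂ x) ((Submodule.subtypeL _) ((b μ).repr ⟨y, hy⟩ i • b μ i)) = 0 := by
        intro i
        have := hx _ (Submodule.subset_span ⟨⟨μ, i⟩, rfl⟩)
        rw [← inner_conj_symm, map_eq_zero] at this
        simp only [map_smul, innerSL_apply_apply, Submodule.subtypeL_apply, smul_eq_mul]
        rw [show ⟪x, ((b μ i : Module.End.eigenspace (T : Module.End ℂ E) μ) : E)⟫_ℂ = 0 from this, mul_zero]
      simp only [h0] at h2
      have := h2.unique hasSum_zero
      rw [← inner_conj_symm, map_eq_zero]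
      exact this
    | zero => simp
    | add y z _ _ hy hz => rw [inner_add_left, hy, hz, add_zero]
  refine ⟨Set.range v, HilbertBasis.mkOfOrthogonalEqBot hon'.toSubtypeRange hsp, ?_⟩
  rintro ⟨_, ⟨i, rfl⟩⟩ ⟨_, ⟨j, rfl⟩⟩ hij
  rw [HilbertBasis.coe_mkOfOrthogonalEqBot]
  have hij' : i ≠ j := fun h => hij (by simp [h])
  have hTj : T (v j) = j.1 • v j := Module.End.mem_eigenspace_iff.1 (b j.1 j.2).2
  change ⟪A (v i), A (v j)⟫_ℂ = 0
  rw [← ContinuousLinearMap.adjoint_inner_right]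
  change ⟪v i, T (v j)⟫_ℂ = 0
  rw [hTj, inner_smul_right, hon'.2 hij', mul_zero]

theorem isCompactOperator_rankOne (x : F) (y : E) : IsCompactOperator (rankOne ℂ x y) := by
  rw [rankOne_def', ContinuousLinearMap.coe_comp]
  exact (isCompactOperator_of_locallyCompactSpace_dom
    (innerSL ℂ y : E →L[ℂ] ℂ)).clm_comp (ContinuousLinearMap.toSpanSingleton ℂ x)

theorem isCompactOperator_sum {ι : Type*} (s : Finset ι) {A : ι → E →L[ℂ] F}
    (h : ∀ i ∈ s, IsCompactOperator (A i)) : IsCompactOperator (∑ i ∈ s, A i : E →L[ℂ] F) :=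
  (compactOperator (RingHom.id ℂ) E F).sum_mem (f := A) h

theorem hasSum_inner_smul_apply {ι : Type*} (b : HilbertBasis ι ℂ E) (A : E →L[ℂ] F) (x : E) :
    HasSum (fun i => ⟪b i, x⟫_ℂ • A (b i)) (A x) := by
  have h := (b.hasSum_repr x).mapL A
  simpa only [map_smul, HilbertBasis.repr_apply_apply] using h

/-- Cauchy-Schwarz on A x = ∑ᵢ ⟨bᵢ, x⟩ A bᵢ: the Hilbert-Schmidt norm dominates the operator norm.
-/
theorem enorm_sq_le_tsum {ι : Type*} (b : HilbertBasis ι ℂ E) (A : E →L[ℂ] F) :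
    ‖A‖ₑ ≤ (∑' i, ‖A (b i)‖ₑ ^ 2) ^ (1 / 2 : ℝ) := by
  refine A.opENorm_le_bound fun x => ?_
  rw [← (hasSum_inner_smul_apply b A x).tsum_eq]
  refine enorm_tsum_le_tsum_enorm.trans ?_
  simp_rw [enorm_smul, mul_comm ‖⟪_, x⟫_ℂ‖ₑ]
  refine (tsum_mul_le_sqrt_mul_sqrt _ _).trans ?_
  rw [b.tsum_enorm_inner_sq x]
  gcongr
  rw [← ENNReal.rpow_natCast, ← ENNReal.rpow_mul]; norm_num

/-- The truncation of `A` to finitely many vectors of a Hilbert basis. -/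
noncomputable def truncate {ι : Type*} (b : HilbertBasis ι ℂ E) (A : E →L[ℂ] F) (s : Finset ι) :
    E →L[ℂ] F := ∑ i ∈ s, rankOne ℂ (A (b i)) (b i)

theorem truncate_apply_self {ι : Type*} [DecidableEq ι] (b : HilbertBasis ι ℂ E) (A : E →L[ℂ] F)
    (s : Finset ι) (i : ι) : truncate b A s (b i) = if i ∈ s then A (b i) else 0 := by
  simp only [truncate, sum_apply, rankOne_apply]
  simp only [orthonormal_iff_ite.1 b.orthonormal, ite_smul, one_smul, zero_smul]
  rw [Finset.sum_ite_eq' s i]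

theorem tendsto_tsum_truncate {ι : Type*} (b : HilbertBasis ι ℂ E) (A : E →L[ℂ] F) {p : ℝ}
    (hp : 0 < p) (h : ∑' i, ‖A (b i)‖ₑ ^ p ≠ ∞) :
    Filter.Tendsto (fun s => ∑' i, ‖(A - truncate b A s) (b i)‖ₑ ^ p) Filter.atTop (nhds 0) := by
  classical
  refine (ENNReal.tendsto_tsum_compl_atTop_zero h).congr fun s => ?_
  have hs (i : ι) : ‖(A - truncate b A s) (b i)‖ₑ ^ p =
      Set.indicator {i | i ∉ s} (fun i => ‖A (b i)‖ₑ ^ p) i := by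
    rw [sub_apply, truncate_apply_self, Set.indicator_apply]
    by_cases hi : i ∈ s <;> simp [hi, hp]
  simp_rw [hs]
  exact tsum_subtype {i | i ∉ s} fun i => ‖A (b i)‖ₑ ^ p

theorem isCompactOperator_truncate {ι : Type*} (b : HilbertBasis ι ℂ E) (A : E →L[ℂ] F)
    (s : Finset ι) : IsCompactOperator (truncate b A s) :=
  isCompactOperator_sum s fun _ _ => isCompactOperator_rankOne _ _

/-- Hilbert-Schmidt operators are operator-norm limits of their finite rank truncations. -/
theorem isCompactOperator_of_tsum_sq {ι : Type*} (b : HilbertBasis ι ℂ E) {A : E →L[ℂ] F}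
    (h : ∑' i, ‖A (b i)‖ₑ ^ 2 ≠ ∞) : IsCompactOperator A := by
  have h2 := tendsto_tsum_truncate b A two_pos (by simpa using h)
  have h3 : Filter.Tendsto (fun s => ‖A - truncate b A s‖ₑ) Filter.atTop (nhds 0) := by
    have h4 := h2.ennrpow_const (1 / 2 : ℝ)
    rw [ENNReal.zero_rpow_of_pos (by norm_num)] at h4
    refine tendsto_of_tendsto_of_tendsto_of_le_of_le tendsto_const_nhds h4 (fun _ => zero_le)
      fun s => ?_
    simpa using enorm_sq_le_tsum b (A - truncate b A s)
  have h5 : Filter.Tendsto (fun s => truncate b A s) Filter.atTop (nhds A) := by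
    rw [tendsto_iff_edist_tendsto_0]
    refine h3.congr fun s => ?_
    rw [edist_comm, edist_eq_enorm_sub]
  exact isCompactOperator_of_tendsto h5 (Filter.Eventually.of_forall
    fun s => isCompactOperator_truncate b A s)

end Compact

/-! ### Schatten norms through diagonalizing bases -/

section Diagonal

open InnerProductSpace

variable {E F G : Type*}
  [NormedAddCommGroup E] [InnerProductSpace ℂ E] [CompleteSpace E]
  [NormedAddCommGroup F] [InnerProductSpace ℂ F] [CompleteSpace F]
  [NormedAddCommGroup G] [InnerProductSpace ℂ G] [CompleteSpace G]

theorem aeval_apply_eigenvector {T : E →L[ℂ] E} {v : E} {t : ℝ} (h : T v = (t : ℂ) • v)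
    (P : Polynomial ℝ) : (Polynomial.aeval T P) v = ((P.eval t : ℝ) : ℂ) • v := by
  have hpow (n : ℕ) : (T ^ n) v = ((t : ℂ) ^ n) • v := by
    induction n with
    | zero => simp
    | succ n ih =>
      rw [pow_succ', mul_apply_eq_comp, ih, map_smul, h, smul_smul, pow_succ]
  induction P using Polynomial.induction_on' with
  | add P Q hP hQ =>
    rw [map_add, add_apply, hP, hQ, Polynomial.eval_add, Complex.ofReal_add, add_smul]
  | monomial n a =>
    rw [Polynomial.aeval_monomial, Polynomial.eval_monomial, ← Algebra.smul_def, smul_apply,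
      hpow, Complex.ofReal_mul, Complex.ofReal_pow, mul_smul, Complex.coe_smul]

/-- Evident for polynomials in T; the power function is a uniform limit of polynomials on an
interval that contains both the spectrum of T and t. -/
theorem rpow_apply_eigenvector {T : E →L[ℂ] E} (hT : 0 ≤ T) {v : E} {t : ℝ} (ht : 0 ≤ t)
    (h : T v = (t : ℂ) • v) {r : ℝ} (hr : 0 ≤ r) : (T ^ r) v = ((t ^ r : ℝ) : ℂ) • v := by
  have hf : Continuous fun x : ℝ => x ^ r := Real.continuous_rpow_const hr
  rw [← sub_eq_zero, ← norm_eq_zero]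
  refine le_antisymm (le_of_forall_pos_le_add fun δ hδ => ?_) (norm_nonneg _)
  -- The approximation error enters twice, once in the operator and once in the scalar.
  obtain ⟨ε, hε, hεδ⟩ : ∃ ε > 0, 2 * ε * ‖v‖ ≤ δ := by
    refine ⟨δ / (2 * (‖v‖ + 1)), by positivity, ?_⟩
    rw [mul_div_assoc', div_mul_eq_mul_div, div_le_iff₀ (by positivity)]
    nlinarith [norm_nonneg v]
  obtain ⟨P, hP⟩ := exists_polynomial_near_of_continuousOn (-max ‖T‖ t) (max ‖T‖ t) _
    hf.continuousOn ε hε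
  have hTsa : IsSelfAdjoint T := .of_nonneg hT
  have h1 : ‖T ^ r - Polynomial.aeval T P‖ ≤ ε := by
    rw [CFC.rpow_eq_cfc_real hT, ← cfc_polynomial P T hTsa,
      ← cfc_sub _ _ T (hf.continuousOn) (P.continuous.continuousOn)]
    refine norm_cfc_le hε.le fun x hx => ?_
    have hx' : ‖x‖ ≤ ‖T‖ * ‖(1 : E →L[ℂ] E)‖ := spectrum.norm_le_norm_mul_of_mem hx
    have hx'' : |x| ≤ max ‖T‖ t := by
      refine (hx'.trans ?_).trans (le_max_left _ _)
      exact mul_le_of_le_one_right (norm_nonneg _) ContinuousLinearMap.norm_id_le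
    rw [norm_sub_rev]
    exact (hP x (abs_le.1 hx'')).le
  have h2 : |P.eval t - t ^ r| ≤ ε :=
    (hP t ⟨by linarith [le_max_right ‖T‖ t], le_max_right _ _⟩).le
  calc ‖(T ^ r) v - ((t ^ r : ℝ) : ℂ) • v‖
      = ‖(T ^ r - Polynomial.aeval T P) v + ((P.eval t - t ^ r : ℝ) : ℂ) • v‖ := by
        rw [sub_apply, aeval_apply_eigenvector h, Complex.ofReal_sub, sub_smul]
        congr 1; abel
    _ ≤ ε * ‖v‖ + ε * ‖v‖ := by
        refine (norm_add_le _ _).trans (add_le_add ?_ ?_)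
        · exact (ContinuousLinearMap.le_opNorm _ _).trans (by gcongr)
        · rw [norm_smul, Complex.norm_real]
          gcongr
          exact h2
    _ ≤ 0 + δ := by linarith

/-- Parseval on both sides of a double sum; in particular the Hilbert-Schmidt sum does not depend on
the basis. -/
theorem tsum_enorm_sq_eq {ι κ : Type*} (b : HilbertBasis ι ℂ E) (c : HilbertBasis κ ℂ F)
    (A : E →L[ℂ] F) : ∑' i, ‖A (b i)‖ₑ ^ 2 = ∑' k, ‖A.adjoint (c k)‖ₑ ^ 2 := by
  simp_rw [← c.tsum_enorm_inner_sq (A _), ← b.tsum_enorm_inner_sq (A.adjoint _)]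
  rw [ENNReal.tsum_comm]
  simp_rw [ContinuousLinearMap.adjoint_inner_right, enorm_inner_comm (c _)]

variable (E) in
theorem exists_hilbertBasis_basisSet :
    ∃ b : HilbertBasis (basisSet E) ℂ E, ⇑b = ((↑) : basisSet E → E) :=
  (exists_hilbertBasis ℂ E).choose_spec

theorem ofReal_re_inner_eq {S : E →L[ℂ] E} (hS : 0 ≤ S) (e : E) :
    ENNReal.ofReal (RCLike.re ⟪e, S e⟫_ℂ) = ‖(CFC.sqrt S) e‖ₑ ^ 2 := by
  have hsa : IsSelfAdjoint (CFC.sqrt S) := .of_nonneg (CFC.sqrt_nonneg S)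
  conv_lhs => rw [← CFC.sqrt_mul_sqrt_self S hS]
  rw [mul_apply_eq_comp, ← ContinuousLinearMap.adjoint_inner_left,
    ← ContinuousLinearMap.star_eq_adjoint, hsa.star_eq, inner_self_eq_norm_sq,
    ENNReal.ofReal_pow (norm_nonneg _), ofReal_norm]

/-- The trace of S is the Hilbert-Schmidt sum of its self-adjoint square root, which is independent
of the basis. -/
theorem posTrace_eq_tsum {ι : Type*} (b : HilbertBasis ι ℂ E) {S : E →L[ℂ] E} (hS : 0 ≤ S) :
    posTrace S = ∑' i, ENNReal.ofReal (RCLike.re ⟪b i, S (b i)⟫_ℂ) := by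
  obtain ⟨c, hc⟩ := exists_hilbertBasis_basisSet E
  have hsa : IsSelfAdjoint (CFC.sqrt S) := .of_nonneg (CFC.sqrt_nonneg S)
  rw [posTrace]
  simp_rw [ofReal_re_inner_eq hS, ← congrFun hc]
  rw [tsum_enorm_sq_eq c b, ← ContinuousLinearMap.star_eq_adjoint, hsa.star_eq]

theorem isCompactOperator_mul_left {S T : E →L[ℂ] E} (hT : IsCompactOperator T) :
    IsCompactOperator (S * T : E →L[ℂ] E) := hT.clm_comp S

theorem isCompactOperator_mul_right {S T : E →L[ℂ] E} (hT : IsCompactOperator T) :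
    IsCompactOperator (T * S : E →L[ℂ] E) := hT.comp_clm S

theorem isCompactOperator_of_posTrace_ne_top {S : E →L[ℂ] E} (hS : 0 ≤ S)
    (h : posTrace S ≠ ∞) : IsCompactOperator S := by
  obtain ⟨c, hc⟩ := exists_hilbertBasis_basisSet E
  rw [posTrace_eq_tsum c hS] at h
  simp_rw [ofReal_re_inner_eq hS] at h
  have h2 := isCompactOperator_mul_left (S := CFC.sqrt S) (isCompactOperator_of_tsum_sq c h)
  rwa [CFC.sqrt_mul_sqrt_self S hS] at h2

theorem isCompactOperator_sqrt {S : E →L[ℂ] E} (hS : 0 ≤ S) (h : IsCompactOperator S) :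
    IsCompactOperator (CFC.sqrt S : E →L[ℂ] E) := by
  have hsa : IsSelfAdjoint (CFC.sqrt S) := .of_nonneg (CFC.sqrt_nonneg S)
  refine isCompactOperator_of_adjoint_comp_self ?_
  rw [← ContinuousLinearMap.star_eq_adjoint, hsa.star_eq, ← ContinuousLinearMap.mul_def,
    CFC.sqrt_mul_sqrt_self S hS]
  exact h

/-- Square roots preserve compactness, so the exponent can be halved until it is below one; then T
is a compact power times a bounded one. -/
theorem isCompactOperator_of_nnrpow {T : E →L[ℂ] E} (hT : 0 ≤ T) {x : NNReal}
    (hx : 0 < x) (h : IsCompactOperator (T ^ x : E →L[ℂ] E)) : IsCompactOperator T := by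
  have hn (n : ℕ) : IsCompactOperator (T ^ (x / 2 ^ n) : E →L[ℂ] E) := by
    induction n with
    | zero => simpa using h
    | succ n ih =>
      have h2 : CFC.sqrt (T ^ (x / 2 ^ n)) = T ^ (x / 2 ^ (n + 1)) := by
        rw [CFC.sqrt_nnrpow, pow_succ, div_div]
      have h0 : (0 : E →L[ℂ] E) ≤ T ^ (x / 2 ^ n) := CFC.nnrpow_nonneg
      have h3 := isCompactOperator_sqrt h0 ih
      rwa [h2] at h3
  obtain ⟨n, hn1⟩ := pow_unbounded_of_one_lt x one_lt_two
  have hlt : x / 2 ^ n < 1 := by rwa [div_lt_one (by positivity)]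
  have hsplit : T ^ (x / 2 ^ n) * T ^ (1 - x / 2 ^ n) = T := by
    rw [← CFC.nnrpow_add (by positivity) (tsub_pos_of_lt hlt), add_tsub_cancel_of_le hlt.le,
      CFC.nnrpow_one T hT]
  have h2 := isCompactOperator_mul_right (S := T ^ (1 - x / 2 ^ n)) (hn n)
  rwa [hsplit] at h2

theorem adjoint_comp_self_nonneg (A : E →L[ℂ] F) : 0 ≤ A.adjoint ∘L A :=
  (ContinuousLinearMap.nonneg_iff_isPositive _).2
    (ContinuousLinearMap.isPositive_adjoint_comp_self A)

theorem isCompactOperator_of_schattenTrace_ne_top {p : ℝ} (hp : 0 < p) {A : E →L[ℂ] F}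
    (h : schattenTrace p A ≠ ∞) : IsCompactOperator A := by
  have h1 := isCompactOperator_of_posTrace_ne_top CFC.rpow_nonneg h
  refine isCompactOperator_of_adjoint_comp_self ?_
  lift p to NNReal using hp.le
  have hx : 0 < p / 2 := by
    have : 0 < p := hp
    positivity
  refine isCompactOperator_of_nnrpow (adjoint_comp_self_nonneg A) hx ?_
  rw [CFC.nnrpow_eq_rpow hx]
  exact h1

namespace IsDiagonalizing

variable {ι κ : Type*} {A : E →L[ℂ] F} {b : HilbertBasis ι ℂ E}

theorem adjoint_comp_self_apply (h : IsDiagonalizing A b) (i : ι) :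
    (A.adjoint ∘L A) (b i) = ((‖A (b i)‖ ^ 2 : ℝ) : ℂ) • b i := by
  refine b.repr.injective (Subtype.ext (funext fun j => ?_))
  rw [HilbertBasis.repr_apply_apply, HilbertBasis.repr_apply_apply, inner_smul_right,
    ContinuousLinearMap.comp_apply, ContinuousLinearMap.adjoint_inner_right]
  by_cases hij : j = i
  · subst hij
    rw [inner_self_eq_norm_sq_to_K, inner_self_eq_norm_sq_to_K, b.orthonormal.1]
    simp
  · rw [h hij, b.orthonormal.2 hij, mul_zero]

theorem schattenTrace_eq (h : IsDiagonalizing A b) {p : ℝ} (hp : 0 < p) :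
    schattenTrace p A = ∑' i, ‖A (b i)‖ₑ ^ p := by
  rw [schattenTrace, posTrace_eq_tsum b CFC.rpow_nonneg]
  refine tsum_congr fun i => ?_
  rw [rpow_apply_eigenvector (adjoint_comp_self_nonneg A) (by positivity)
    (h.adjoint_comp_self_apply i) (by positivity), inner_smul_right,
    inner_self_eq_norm_sq_to_K, b.orthonormal.1, ← Real.rpow_natCast, ← Real.rpow_mul (norm_nonneg _)]
  simp only [Nat.cast_ofNat, mul_div_cancel₀ p two_ne_zero]
  simp [← ENNReal.ofReal_rpow_of_nonneg (norm_nonneg _) hp.le]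

/-- The normalized images of the vectors of the basis. -/
noncomputable def image (A : E →L[ℂ] F) (b : HilbertBasis ι ℂ E) (i : ι) : F :=
  ((‖A (b i)‖ : ℂ)⁻¹) • A (b i)

/-- Valid also when A bᵢ = 0, where `image` takes the value zero. -/
theorem norm_smul_image (i : ι) : (‖A (b i)‖ : ℂ) • image A b i = A (b i) := by
  by_cases hi : A (b i) = 0
  · simp [hi]
  · rw [image, smul_inv_smul₀]
    simpa using hi

theorem enorm_inner_apply_eq (y : F) (i : ι) :
    ‖⟪y, A (b i)⟫_ℂ‖ₑ = ‖⟪image A b i, y⟫_ℂ‖ₑ * ‖A (b i)‖ₑ := by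
  conv_lhs => rw [← norm_smul_image (A := A) (b := b) i]
  rw [inner_smul_right, enorm_mul, enorm_inner_comm, mul_comm, ← ofReal_norm (‖A (b i)‖ : ℂ),
    Complex.norm_real, norm_norm, ofReal_norm]

/-- The nonzero members are orthonormal and the zero ones contribute nothing. -/
theorem isBessel_image (h : IsDiagonalizing A b) : IsBessel (image A b) := fun u => by
  have hon : Orthonormal ℂ fun i : {i // A (b i) ≠ 0} => image A b i := by
    refine ⟨fun i => ?_, fun i j hij => ?_⟩
    · have := norm_ne_zero_iff.2 i.2
      change ‖((‖A (b i)‖ : ℂ)⁻¹) • A (b i)‖ = 1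
      rw [norm_smul, norm_inv, Complex.norm_real, norm_norm, inv_mul_cancel₀ this]
    · change ⟪((‖A (b i)‖ : ℂ)⁻¹) • A (b i), ((‖A (b j)‖ : ℂ)⁻¹) • A (b j)⟫_ℂ = 0
      rw [inner_smul_left, inner_smul_right,
        h (fun hh => hij (Subtype.ext hh)), mul_zero, mul_zero]
  refine le_trans (le_of_eq ?_) (hon.isBessel u)
  refine (tsum_subtype_eq_of_support_subset (f := fun i => ‖⟪image A b i, u⟫_ℂ‖ₑ ^ 2)
    (s := {i | A (b i) ≠ 0}) fun i hi => ?_).symm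
  rintro h0
  refine hi ?_
  simp [image, h0]

/-- The supremum is attained at x = b and y = `image A b`. It is no larger because |⟨yⱼ, A xⱼ⟩| is
at most the average of the ‖A bᵢ‖ against the doubly substochastic matrix |⟨bᵢ, xⱼ⟩| |⟨uᵢ, yⱼ⟩|,
where u is `image A b`. -/
theorem schattenSup_eq (h : IsDiagonalizing A b) {p : ℝ} (hp : 1 ≤ p) :
    schattenSup p A = ∑' i, ‖A (b i)‖ₑ ^ p := by
  refine le_antisymm (schattenSup_le_iff.2 fun n x y hx hy => ?_) ?_
  · have hb := b.orthonormal.isBessel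
    have hu := h.isBessel_image
    calc ∑ j, ‖⟪y j, A (x j)⟫_ℂ‖ₑ ^ p
        ≤ ∑ j, (∑' i, (‖⟪b i, x j⟫_ℂ‖ₑ * ‖⟪image A b i, y j⟫_ℂ‖ₑ) * ‖A (b i)‖ₑ) ^ p := by
          gcongr with j
          have hs := (hasSum_inner_smul_apply b A (x j)).mapL (innerSL ℂ (y j))
          rw [innerSL_apply_apply] at hs
          rw [← hs.tsum_eq]
          refine enorm_tsum_le_tsum_enorm.trans (ENNReal.tsum_le_tsum fun i => le_of_eq ?_)
          rw [innerSL_apply_apply, inner_smul_right, enorm_mul, enorm_inner_apply_eq, mul_assoc]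
      _ ≤ _ := by
          rw [← tsum_fintype (L := .unconditional _)]
          refine tsum_rpow_tsum_mul_le hp _ _ (fun j => ?_) (fun i => ?_)
          · exact hb.tsum_mul_le_one hu (hx.enorm_le_one j) (hy.enorm_le_one j)
          · simp_rw [enorm_inner_comm (b i), enorm_inner_comm (image A b i)]
            exact hx.tsum_mul_le_one hy (hb.enorm_le_one i) (hu.enorm_le_one i)
  · refine le_trans (le_of_eq (tsum_congr fun i => ?_))
      (tsum_le_schattenSup p A b.orthonormal.isBessel h.isBessel_image)
    by_cases hi : A (b i) = 0
    · simp [hi, one_pos.trans_le hp]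
    congr 1
    rw [image, inner_smul_left, enorm_mul, enorm_inner_self, ← ofReal_norm, ← ofReal_norm,
      RCLike.norm_conj, norm_inv, Complex.norm_real, norm_norm, ← ENNReal.ofReal_pow (norm_nonneg _),
      ← ENNReal.ofReal_mul (by positivity)]
    have := norm_ne_zero_iff.2 hi
    congr 1
    field_simp

end IsDiagonalizing

variable {p q : ℝ≥0∞}

theorem schattenTrace_eq_schattenSup {p : ℝ} (hp : 1 ≤ p) {A : E →L[ℂ] F}
    (hA : IsCompactOperator A) : schattenTrace p A = schattenSup p A := by
  obtain ⟨s, b, hb⟩ := exists_isDiagonalizing hA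
  rw [hb.schattenTrace_eq (one_pos.trans_le hp), hb.schattenSup_eq hp]

/-- Compactness is listed separately because the supremum and the trace are only identified on
compact operators; a finite trace implies it. -/
theorem memSchatten_iff (hp : 1 ≤ p) {A : E →L[ℂ] F} :
    MemSchatten p A ↔ IsCompactOperator A ∧ schattenENorm p A < ∞ := by
  rw [MemSchatten]
  split_ifs with hp'
  · subst hp'
    simp [schattenENorm_top]
  have h1 := one_le_toReal hp hp'
  have h0 := toReal_pos_of_one_le hp hp'
  rw [schattenENorm_of_ne_top hp', ENNReal.rpow_lt_top_iff_of_pos (by positivity)]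
  constructor
  · intro h
    have hA := isCompactOperator_of_schattenTrace_ne_top h0 h.ne
    exact ⟨hA, (schattenTrace_eq_schattenSup h1 hA) ▸ h⟩
  · rintro ⟨hA, h⟩
    rwa [schattenTrace_eq_schattenSup h1 hA]

theorem MemSchatten.schattenNorm_eq (hp : 1 ≤ p) {A : E →L[ℂ] F} (hA : MemSchatten p A) :
    schattenNorm p A = (schattenENorm p A).toReal := by
  rw [schattenNorm]
  split_ifs with hp'
  · subst hp'
    rw [schattenENorm_top, toReal_enorm]
  rw [schattenENorm_of_ne_top hp', ENNReal.toReal_rpow,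
    schattenTrace_eq_schattenSup (one_le_toReal hp hp') ((memSchatten_iff hp).1 hA).1]

end Diagonal

section Operators

open InnerProductSpace

variable {E F G : Type*}
  [NormedAddCommGroup E] [InnerProductSpace ℂ E] [CompleteSpace E]
  [NormedAddCommGroup F] [InnerProductSpace ℂ F] [CompleteSpace F]
  [NormedAddCommGroup G] [InnerProductSpace ℂ G] [CompleteSpace G]

variable {p q : ℝ≥0∞}

/-! ### Finite rank operators built from Bessel families -/

theorem inner_sum_smul_rankOne {n : ℕ} (c : Fin n → ℂ) (x : Fin n → F) (y : Fin n → E)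
    (u : E) (v : F) : ⟪v, (∑ j, c j • rankOne ℂ (x j) (y j) : E →L[ℂ] F) u⟫_ℂ =
      ∑ j, c j * (⟪y j, u⟫_ℂ * ⟪v, x j⟫_ℂ) := by
  simp only [sum_apply, smul_apply, rankOne_apply, inner_sum, inner_smul_right]

theorem enorm_inner_sum_smul_rankOne_le {n : ℕ} (c : Fin n → ℂ) (x : Fin n → F) (y : Fin n → E)
    (u : E) (v : F) : ‖⟪v, (∑ j, c j • rankOne ℂ (x j) (y j) : E →L[ℂ] F) u⟫_ℂ‖ₑ ≤
      ∑' j, (‖⟪y j, u⟫_ℂ‖ₑ * ‖⟪x j, v⟫_ℂ‖ₑ) * ‖c j‖ₑ := by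
  rw [inner_sum_smul_rankOne, tsum_fintype]
  refine (enorm_sum_le _ _).trans (Finset.sum_le_sum fun j _ => le_of_eq ?_)
  rw [enorm_mul, enorm_mul, enorm_inner_comm v, mul_comm]

/-- Pairing T u with itself and using Cauchy-Schwarz gives ‖Tu‖² ≤ ‖u‖ ‖Tu‖. -/
theorem enorm_sum_smul_rankOne_le {n : ℕ} {c : Fin n → ℂ} {x : Fin n → F} {y : Fin n → E}
    (hx : IsBessel x) (hy : IsBessel y) (hc : ∀ j, ‖c j‖ₑ ≤ 1) :
    ‖(∑ j, c j • rankOne ℂ (x j) (y j) : E →L[ℂ] F)‖ₑ ≤ 1 := by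
  set T : E →L[ℂ] F := ∑ j, c j • rankOne ℂ (x j) (y j) with hT
  refine T.opENorm_le_bound fun u => ?_
  have h : ‖T u‖ₑ * ‖T u‖ₑ ≤ ‖u‖ₑ * ‖T u‖ₑ := by
    rw [← sq, ← enorm_inner_self]
    refine (enorm_inner_sum_smul_rankOne_le c x y u (T u)).trans ?_
    refine (ENNReal.tsum_le_tsum fun j => mul_le_of_le_one_right' (hc j)).trans ?_
    exact hy.tsum_mul_le hx u (T u)
  by_cases h0 : ‖T u‖ₑ = 0
  · rw [h0]; exact zero_le
  rw [one_mul]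
  exact (ENNReal.mul_le_mul_iff_left h0 enorm_ne_top).1 h

/-- Jensen again, with the moduli |cⱼ| in the role of singular values. These are the test operators
for the duality of L_p and L_q. -/
theorem schattenENorm_sum_smul_rankOne_le (hq : 1 ≤ q) (hq' : q ≠ ∞) {n : ℕ} (c : Fin n → ℂ)
    {x : Fin n → F} {y : Fin n → E} (hx : IsBessel x) (hy : IsBessel y) :
    schattenENorm q (∑ j, c j • rankOne ℂ (x j) (y j) : E →L[ℂ] F) ≤
      (∑ j, ‖c j‖ₑ ^ q.toReal) ^ (1 / q.toReal) := by
  rw [schattenENorm_of_ne_top hq']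
  gcongr
  refine schattenSup_le_iff.2 fun m u v hu hv => ?_
  have h0 := toReal_pos_of_one_le hq hq'
  calc _ ≤ ∑ k, (∑' j, (‖⟪y j, u k⟫_ℂ‖ₑ * ‖⟪x j, v k⟫_ℂ‖ₑ) * ‖c j‖ₑ) ^ q.toReal := by
        gcongr with k
        exact enorm_inner_sum_smul_rankOne_le c x y (u k) (v k)
    _ ≤ _ := by
        rw [← tsum_fintype (L := .unconditional _), ← tsum_fintype (L := .unconditional _)]
        refine tsum_rpow_tsum_mul_le (one_le_toReal hq hq') _ _ (fun k => ?_) (fun j => ?_)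
        · exact hy.tsum_mul_le_one hx (hu.enorm_le_one k) (hv.enorm_le_one k)
        · simp_rw [enorm_inner_comm (y j), enorm_inner_comm (x j)]
          exact hu.tsum_mul_le_one hv (hy.enorm_le_one j) (hx.enorm_le_one j)

theorem schattenENorm_rankOne_le (hq : 1 ≤ q) (x : F) (y : E) :
    schattenENorm q (rankOne ℂ x y) ≤ ‖x‖ₑ * ‖y‖ₑ := by
  -- The exponent 1 gives the largest of the norms, so it suffices to bound that one.
  refine (schattenENorm_anti le_rfl hq _).trans ?_
  have hx : (‖x‖ : ℂ) • (((‖x‖ : ℂ)⁻¹) • x) = x := by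
    by_cases hx : x = 0
    · simp [hx]
    · rw [smul_inv_smul₀]; simpa using hx
  have hy : (‖y‖ : ℂ) • (((‖y‖ : ℂ)⁻¹) • y) = y := by
    by_cases hy : y = 0
    · simp [hy]
    · rw [smul_inv_smul₀]; simpa using hy
  have h := schattenENorm_sum_smul_rankOne_le le_rfl ENNReal.one_ne_top
    (fun _ : Fin 1 => (‖x‖ * ‖y‖ : ℂ)) (isBessel_const (enorm_normalize_le x))
    (isBessel_const (enorm_normalize_le y))
  have hr : rankOne ℂ x y = (‖x‖ * ‖y‖ : ℂ) •
      rankOne ℂ (((‖x‖ : ℂ)⁻¹) • x) (((‖y‖ : ℂ)⁻¹) • y) := by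
    conv_lhs => rw [← hx, ← hy]
    simp only [map_smul, map_smulₛₗ, smul_apply, smul_smul, Complex.conj_ofReal, map_inv₀]
    congr 1
    simp only [map_mul, map_inv₀, Complex.conj_ofReal]
    ring
  have hn (a : ℝ) (ha : 0 ≤ a) : ‖(a : ℂ)‖ₑ = ENNReal.ofReal a := by
    rw [← ofReal_norm, Complex.norm_real, Real.norm_of_nonneg ha]
  simp only [Finset.univ_unique, Finset.sum_singleton, enorm_mul, ENNReal.toReal_one,
    ENNReal.rpow_one, one_div_one, hn _ (norm_nonneg _), ofReal_norm] at h
  rw [hr]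
  exact h

/-! ### Compactness -/

theorem isCompactOperator_adjoint {A : E →L[ℂ] F} (hA : IsCompactOperator A) :
    IsCompactOperator A.adjoint := by
  refine isCompactOperator_of_adjoint_comp_self ?_
  rw [ContinuousLinearMap.adjoint_adjoint, ContinuousLinearMap.coe_comp]
  exact hA.comp_clm _

theorem schattenTrace_two {ι : Type*} (b : HilbertBasis ι ℂ E) (A : E →L[ℂ] F) :
    schattenTrace 2 A = ∑' i, ‖A (b i)‖ₑ ^ 2 := by
  rw [schattenTrace, div_self two_ne_zero, CFC.rpow_one _ (adjoint_comp_self_nonneg A),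
    posTrace_eq_tsum b (adjoint_comp_self_nonneg A)]
  refine tsum_congr fun i => ?_
  rw [ContinuousLinearMap.comp_apply, ContinuousLinearMap.adjoint_inner_right,
    inner_self_eq_norm_sq, ENNReal.ofReal_pow (norm_nonneg _), ofReal_norm]

/-- A truncation is A composed with the projection onto the span of finitely many basis vectors,
which is a contraction. -/
theorem schattenENorm_truncate_le (hp : 1 ≤ p) {ι : Type*} (b : HilbertBasis ι ℂ E)
    (A : E →L[ℂ] F) (s : Finset ι) : schattenENorm p (truncate b A s) ≤ schattenENorm p A := by
  have hinj : Function.Injective fun k : Fin s.card => ((s.equivFin.symm k : s) : ι) :=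
    Subtype.val_injective.comp s.equivFin.symm.injective
  have hb := b.orthonormal.isBessel.comp_injective hinj
  have h : truncate b A s = A ∘L ∑ k : Fin s.card, (1 : ℂ) •
      rankOne ℂ (b (s.equivFin.symm k : s)) (b (s.equivFin.symm k : s)) := by
    simp only [one_smul, ContinuousLinearMap.comp_finsetSum, comp_rankOne]
    rw [truncate, ← Finset.sum_coe_sort s]
    exact (Equiv.sum_comp s.equivFin.symm fun i : s => rankOne ℂ (A (b i)) (b i)).symm
  rw [h]
  refine (schattenENorm_comp_le' hp _ _).trans (mul_le_of_le_one_right' ?_)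
  exact enorm_sum_smul_rankOne_le hb hb fun _ => by simp

/-- Truncations are compact, so their Hilbert-Schmidt norm is the Schatten 2-norm, at most the
p-norm as p ≤ 2. The bound is uniform, whence A is Hilbert-Schmidt. -/
theorem isCompactOperator_of_schattenENorm_ne_top (hp : 1 ≤ p) (hp2 : p ≤ 2) {A : E →L[ℂ] F}
    (h : schattenENorm p A ≠ ∞) : IsCompactOperator A := by
  classical
  obtain ⟨w, b, -⟩ := exists_hilbertBasis ℂ E
  refine isCompactOperator_of_tsum_sq b (ne_top_of_le_ne_top (b := schattenENorm p A ^ 2)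
    (by finiteness) ?_)
  rw [ENNReal.tsum_eq_iSup_sum]
  refine iSup_le fun s => ?_
  have h2 := (schattenENorm_anti hp hp2 (truncate b A s)).trans (schattenENorm_truncate_le hp b A s)
  rw [schattenENorm_le_iff (by norm_num) (by norm_num), ENNReal.toReal_ofNat,
    ← schattenTrace_eq_schattenSup one_le_two (isCompactOperator_truncate b A s),
    schattenTrace_two b, ENNReal.rpow_ofNat] at h2
  refine le_trans ?_ h2
  refine le_trans (le_of_eq (Finset.sum_congr rfl fun i hi => ?_)) (ENNReal.sum_le_tsum s)
  rw [truncate_apply_self, if_pos hi]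

/-! ### Hölder's inequality -/

theorem exists_phase (z : ℂ) : ∃ c : ℂ, ‖c‖ ≤ 1 ∧ c * z = ‖z‖ := by
  by_cases hz : z = 0
  · exact ⟨0, by simp, by simp [hz]⟩
  · have h : (‖z‖ : ℂ) ≠ 0 := by simpa using hz
    refine ⟨(starRingEnd ℂ) z / ‖z‖, ?_, ?_⟩
    · rw [norm_div, Complex.norm_conj, Complex.norm_real, norm_norm,
        div_self (norm_ne_zero_iff.2 hz)]
    · rw [div_mul_eq_mul_div, mul_comm, Complex.mul_conj, Complex.normSq_eq_norm_sq]
      field_simp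
      norm_cast

/-- With the contraction W = ∑ⱼ yⱼ xⱼ*, the sum is the trace of W*AB. Expanding A* and B in
diagonalizing bases f and g gives a bilinear form in the numbers ‖A* fₖ‖ and ‖B gₘ‖ with a doubly
substochastic matrix; Hölder in k and Jensen in m finish. -/
theorem enorm_sum_inner_comp_le (hp : 1 ≤ p) (hp' : p ≠ ∞) (hq : 1 ≤ q) (hq' : q ≠ ∞)
    (hpq : p.toReal.HolderConjugate q.toReal) {A : F →L[ℂ] G} {B : E →L[ℂ] F}
    (hA : IsCompactOperator A) (hB : IsCompactOperator B) {n : ℕ} {x : Fin n → E} {y : Fin n → G}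
    (hx : IsBessel x) (hy : IsBessel y) :
    ‖∑ j, ⟪y j, (A ∘L B) (x j)⟫_ℂ‖ₑ ≤ schattenENorm p A * schattenENorm q B := by
  obtain ⟨s, f, hf⟩ := exists_isDiagonalizing (isCompactOperator_adjoint hA)
  obtain ⟨t, g, hg⟩ := exists_isDiagonalizing hB
  set W : E →L[ℂ] G := ∑ j, (1 : ℂ) • rankOne ℂ (y j) (x j) with hW
  have hW1 : ‖W‖ₑ ≤ 1 := enorm_sum_smul_rankOne_le hy hx fun _ => by simp
  have hW2 : ‖W.adjoint‖ₑ ≤ 1 := by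
    rwa [← ofReal_norm, LinearIsometryEquiv.norm_map, ofReal_norm]
  have hsum : HasSum (fun m => ⟪A.adjoint (W (g m)), B (g m)⟫_ℂ)
      (∑ j, ⟪y j, (A ∘L B) (x j)⟫_ℂ) := by
    have h1 (j : Fin n) := (hasSum_inner_smul_apply g B (x j)).mapL (innerSL ℂ (A.adjoint (y j)))
    have h2 := hasSum_sum fun j (_ : j ∈ Finset.univ) => h1 j
    simp only [innerSL_apply_apply, inner_smul_right, ContinuousLinearMap.adjoint_inner_left] at h2
    refine h2.congr_fun ?_
    intro m
    simp only [hW, ContinuousLinearMap.adjoint_inner_left, sum_apply, one_smul,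
      rankOne_apply, sum_inner, inner_smul_left, inner_conj_symm]
  set u := IsDiagonalizing.image A.adjoint f with hu
  set v := IsDiagonalizing.image B g with hv
  have hub : IsBessel u := hf.isBessel_image
  have hvb : IsBessel v := hg.isBessel_image
  have hfb := f.orthonormal.isBessel
  have hgb := g.orthonormal.isBessel
  have hterm (m) : ‖⟪A.adjoint (W (g m)), B (g m)⟫_ℂ‖ₑ ≤
      ∑' k, ‖A.adjoint (f k)‖ₑ * ((‖⟪f k, W (g m)⟫_ℂ‖ₑ * ‖⟪u k, v m⟫_ℂ‖ₑ) * ‖B (g m)‖ₑ) := by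
    rw [enorm_inner_comm]
    have h1 := (hasSum_inner_smul_apply f A.adjoint (W (g m))).mapL (innerSL ℂ (B (g m)))
    rw [innerSL_apply_apply] at h1
    rw [← h1.tsum_eq]
    refine enorm_tsum_le_tsum_enorm.trans (ENNReal.tsum_le_tsum fun k => le_of_eq ?_)
    rw [innerSL_apply_apply, inner_smul_right, enorm_mul,
      IsDiagonalizing.enorm_inner_apply_eq (A := A.adjoint) (b := f) (B (g m)) k,
      IsDiagonalizing.enorm_inner_apply_eq (A := B) (b := g) _ m, enorm_inner_comm (v m)]
    ring
  calc ‖∑ j, ⟪y j, (A ∘L B) (x j)⟫_ℂ‖ₑ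
      ≤ ∑' m, ∑' k, ‖A.adjoint (f k)‖ₑ *
          ((‖⟪f k, W (g m)⟫_ℂ‖ₑ * ‖⟪u k, v m⟫_ℂ‖ₑ) * ‖B (g m)‖ₑ) := by
        rw [← hsum.tsum_eq]
        exact enorm_tsum_le_tsum_enorm.trans (ENNReal.tsum_le_tsum hterm)
    _ = ∑' k, ‖A.adjoint (f k)‖ₑ *
          ∑' m, (‖⟪f k, W (g m)⟫_ℂ‖ₑ * ‖⟪u k, v m⟫_ℂ‖ₑ) * ‖B (g m)‖ₑ := by
        rw [ENNReal.tsum_comm]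
        simp_rw [ENNReal.tsum_mul_left]
    _ ≤ (∑' k, ‖A.adjoint (f k)‖ₑ ^ p.toReal) ^ (1 / p.toReal) *
          (∑' k, (∑' m, (‖⟪f k, W (g m)⟫_ℂ‖ₑ * ‖⟪u k, v m⟫_ℂ‖ₑ) * ‖B (g m)‖ₑ) ^ q.toReal) ^
            (1 / q.toReal) := tsum_mul_le_Lp_mul_Lq hpq _ _
    _ ≤ (∑' k, ‖A.adjoint (f k)‖ₑ ^ p.toReal) ^ (1 / p.toReal) *
          (∑' m, ‖B (g m)‖ₑ ^ q.toReal) ^ (1 / q.toReal) := by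
        gcongr
        refine tsum_rpow_tsum_mul_le (one_le_toReal hq hq') _ _ (fun k => ?_) (fun m => ?_)
        · simp_rw [← ContinuousLinearMap.adjoint_inner_left W, enorm_inner_comm (W.adjoint (f k)),
            enorm_inner_comm (u k)]
          refine hgb.tsum_mul_le_one hvb ?_ (hub.enorm_le_one k)
          exact (W.adjoint.le_opENorm _).trans (mul_le_one' hW2 (hfb.enorm_le_one k))
        · refine hfb.tsum_mul_le_one hub ?_ (hvb.enorm_le_one m)
          exact (W.le_opENorm _).trans (mul_le_one' hW1 (hgb.enorm_le_one m))
    _ = _ := by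
        rw [← hf.schattenSup_eq (one_le_toReal hp hp'), ← hg.schattenSup_eq (one_le_toReal hq hq'),
          ← schattenENorm_of_ne_top hp', ← schattenENorm_of_ne_top hq', schattenENorm_adjoint hp]

theorem holderConjugate_toReal (hp : 1 ≤ p) (hq : 1 ≤ q) (hp' : p ≠ ∞) (hq' : q ≠ ∞)
    (hpq : p⁻¹ + q⁻¹ = 1) : p.toReal.HolderConjugate q.toReal := by
  refine ⟨?_, toReal_pos_of_one_le hp hp', toReal_pos_of_one_le hq hq'⟩
  have h := congrArg ENNReal.toReal hpq
  rw [ENNReal.toReal_add (ENNReal.inv_ne_top.2 (one_pos.trans_le hp).ne')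
    (ENNReal.inv_ne_top.2 (one_pos.trans_le hq).ne'), ENNReal.toReal_inv, ENNReal.toReal_inv] at h
  simpa using h

/-- When one exponent is infinite this is the ideal property. Otherwise the phases of ⟨yⱼ, AB xⱼ⟩
are absorbed into the xⱼ, which stay Bessel. -/
theorem schattenENorm_comp_le_mul (hp : 1 ≤ p) (hq : 1 ≤ q) (hpq : p⁻¹ + q⁻¹ = 1)
    {A : F →L[ℂ] G} {B : E →L[ℂ] F} (hA : IsCompactOperator A) (hB : IsCompactOperator B) :
    schattenENorm 1 (A ∘L B) ≤ schattenENorm p A * schattenENorm q B := by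
  by_cases hp' : p = ∞
  · have hq1 : q = 1 := by simpa [hp'] using hpq
    rw [hp', hq1, schattenENorm_top]
    exact schattenENorm_comp_le le_rfl A B
  by_cases hq' : q = ∞
  · have hp1 : p = 1 := by simpa [hq'] using hpq
    rw [hq', hp1, schattenENorm_top]
    exact schattenENorm_comp_le' le_rfl A B
  have hconj := holderConjugate_toReal hp hq hp' hq' hpq
  rw [schattenENorm_one]
  refine schattenSup_le_iff.2 fun n x y hx hy => ?_
  choose c hc1 hc2 using fun j => exists_phase ⟪y j, (A ∘L B) (x j)⟫_ℂ
  have hc1' (j) : ‖c j‖ₑ ≤ 1 := by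
    rw [← ofReal_norm]; exact ENNReal.ofReal_le_one.2 (hc1 j)
  refine le_trans (le_of_eq ?_) (enorm_sum_inner_comp_le hp hp' hq hq' hconj hA hB
    (hx.smul hc1') hy)
  simp only [map_smul, inner_smul_right, hc2, ENNReal.rpow_one]
  rw [← Complex.ofReal_sum, ← ofReal_norm, Complex.norm_real,
    Real.norm_of_nonneg (Finset.sum_nonneg fun _ _ => norm_nonneg _),
    ENNReal.ofReal_sum_of_nonneg fun _ _ => norm_nonneg _]
  simp only [ofReal_norm]

end Operators

section Classes

open InnerProductSpace

variable {E F G : Type*}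
  [NormedAddCommGroup E] [InnerProductSpace ℂ E] [CompleteSpace E]
  [NormedAddCommGroup F] [InnerProductSpace ℂ F] [CompleteSpace F]
  [NormedAddCommGroup G] [InnerProductSpace ℂ G] [CompleteSpace G]

variable {p q : ℝ≥0∞}

/-! ### Algebra of Schatten classes -/

namespace MemSchatten

variable {A B : E →L[ℂ] F}

theorem isCompactOperator (hp : 1 ≤ p) (hA : MemSchatten p A) : IsCompactOperator A :=
  ((memSchatten_iff hp).1 hA).1

theorem schattenENorm_lt_top (hp : 1 ≤ p) (hA : MemSchatten p A) : schattenENorm p A < ∞ :=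
  ((memSchatten_iff hp).1 hA).2

theorem add (hp : 1 ≤ p) (hA : MemSchatten p A) (hB : MemSchatten p B) :
    MemSchatten p (A + B) := by
  rw [memSchatten_iff hp] at *
  exact ⟨hA.1.add hB.1, (schattenENorm_add_le hp A B).trans_lt (ENNReal.add_lt_top.2 ⟨hA.2, hB.2⟩)⟩

theorem smul (hp : 1 ≤ p) (c : ℂ) (hA : MemSchatten p A) : MemSchatten p (c • A) := by
  rw [memSchatten_iff hp] at *
  refine ⟨hA.1.smul c, ?_⟩
  rw [schattenENorm_smul hp]
  exact ENNReal.mul_lt_top enorm_lt_top hA.2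

theorem zero (hp : 1 ≤ p) : MemSchatten p (0 : E →L[ℂ] F) := by
  rw [memSchatten_iff hp, schattenENorm_zero hp]
  exact ⟨isCompactOperator_zero, by simp⟩

theorem sub (hp : 1 ≤ p) (hA : MemSchatten p A) (hB : MemSchatten p B) :
    MemSchatten p (A - B) := by
  rw [sub_eq_add_neg, ← neg_one_smul ℂ B]
  exact hA.add hp (hB.smul hp _)

theorem clm_comp (hp : 1 ≤ p) (hA : MemSchatten p A) (S : F →L[ℂ] G) :
    MemSchatten p (S ∘L A) := by
  rw [memSchatten_iff hp] at *
  refine ⟨hA.1.clm_comp S, (schattenENorm_comp_le hp S A).trans_lt ?_⟩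
  exact ENNReal.mul_lt_top enorm_lt_top hA.2

theorem comp_clm (hp : 1 ≤ p) (hA : MemSchatten p A) (S : G →L[ℂ] E) :
    MemSchatten p (A ∘L S) := by
  rw [memSchatten_iff hp] at *
  refine ⟨hA.1.comp_clm S, (schattenENorm_comp_le' hp A S).trans_lt ?_⟩
  exact ENNReal.mul_lt_top hA.2 enorm_lt_top

theorem mono (hp : 1 ≤ p) (hpq : p ≤ q) (hA : MemSchatten p A) : MemSchatten q A := by
  rw [memSchatten_iff (hp.trans hpq)]
  exact ⟨hA.isCompactOperator hp,
    (schattenENorm_anti hp hpq A).trans_lt (hA.schattenENorm_lt_top hp)⟩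

theorem adjoint (hp : 1 ≤ p) (hA : MemSchatten p A) : MemSchatten p A.adjoint := by
  rw [memSchatten_iff hp] at *
  exact ⟨isCompactOperator_adjoint hA.1, by rw [schattenENorm_adjoint hp]; exact hA.2⟩

theorem comp (hp : 1 ≤ p) (hq : 1 ≤ q) (hpq : p⁻¹ + q⁻¹ = 1) {S : F →L[ℂ] G}
    (hS : MemSchatten p S) (hA : MemSchatten q A) : MemSchatten 1 (S ∘L A) := by
  rw [memSchatten_iff le_rfl]
  refine ⟨(hA.isCompactOperator hq).clm_comp S, (schattenENorm_comp_le_mul hp hq hpq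
    (hS.isCompactOperator hp) (hA.isCompactOperator hq)).trans_lt ?_⟩
  exact ENNReal.mul_lt_top (hS.schattenENorm_lt_top hp) (hA.schattenENorm_lt_top hq)

end MemSchatten

theorem memSchatten_of_tendsto (hp : 1 ≤ p) {A : ℕ → E →L[ℂ] F} {B : E →L[ℂ] F}
    (h : Filter.Tendsto A Filter.atTop (nhds B)) {C : ℝ≥0∞} (hC : C ≠ ∞)
    (hA : ∀ n, MemSchatten p (A n)) (hAC : ∀ n, schattenENorm p (A n) ≤ C) :
    MemSchatten p B := by
  rw [memSchatten_iff hp]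
  exact ⟨isCompactOperator_of_tendsto h (.of_forall fun n => (hA n).isCompactOperator hp),
    (schattenENorm_le_of_tendsto hp h (.of_forall hAC)).trans_lt hC.lt_top⟩

/-! ### The trace -/

theorem tsum_enorm_inner_le_schattenENorm_one (T : E →L[ℂ] E) :
    ∑' e : basisSet E, ‖⟪(e : E), T e⟫_ℂ‖ₑ ≤ schattenENorm 1 T := by
  obtain ⟨c, hc⟩ := exists_hilbertBasis_basisSet E
  rw [schattenENorm_one]
  have h := tsum_le_schattenSup 1 T c.orthonormal.isBessel c.orthonormal.isBessel
  simpa [hc] using h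

theorem MemSchatten.summable_inner {T : E →L[ℂ] E} (hT : MemSchatten 1 T) :
    Summable fun e : basisSet E => ⟪(e : E), T e⟫_ℂ := by
  refine Summable.of_norm (tsum_enorm_ne_top_iff_summable_norm.1 ?_)
  exact ((tsum_enorm_inner_le_schattenENorm_one T).trans_lt (hT.schattenENorm_lt_top le_rfl)).ne

theorem enorm_trace_le (T : E →L[ℂ] E) : ‖trace T‖ₑ ≤ schattenENorm 1 T :=
  enorm_tsum_le_tsum_enorm.trans (tsum_enorm_inner_le_schattenENorm_one T)

theorem trace_add {S T : E →L[ℂ] E} (hS : MemSchatten 1 S) (hT : MemSchatten 1 T) :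
    trace (S + T) = trace S + trace T := by
  simp only [trace, add_apply, inner_add_right]
  exact hS.summable_inner.tsum_add hT.summable_inner

theorem trace_smul (c : ℂ) (T : E →L[ℂ] E) : trace (c • T) = c * trace T := by
  simp only [trace, smul_apply, inner_smul_right]
  exact tsum_mul_left

theorem trace_rankOne (x y : E) : trace (rankOne ℂ x y) = ⟪y, x⟫_ℂ := by
  obtain ⟨c, hc⟩ := exists_hilbertBasis_basisSet E
  rw [trace, ← c.tsum_inner_mul_inner]
  simp [hc]

/-! ### Finite rank operators -/

variable (E F) in
/-- The operators of finite rank, as the span of the operators of rank one. -/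
noncomputable def finiteRank : Submodule ℂ (E →L[ℂ] F) :=
  Submodule.span ℂ {T | ∃ x y, T = rankOne ℂ x y}

theorem rankOne_mem_finiteRank (x : F) (y : E) : rankOne ℂ x y ∈ finiteRank E F :=
  Submodule.subset_span ⟨x, y, rfl⟩

theorem memSchatten_of_mem_finiteRank (hp : 1 ≤ p) {R : E →L[ℂ] F} (hR : R ∈ finiteRank E F) :
    MemSchatten p R := by
  induction hR using Submodule.span_induction with
  | mem T hT =>
    obtain ⟨x, y, rfl⟩ := hT
    exact (memSchatten_iff hp).2 ⟨isCompactOperator_rankOne x y,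
      (schattenENorm_rankOne_le hp x y).trans_lt (ENNReal.mul_lt_top enorm_lt_top enorm_lt_top)⟩
  | zero => exact .zero hp
  | add S T _ _ hS hT => exact hS.add hp hT
  | smul c T _ hT => exact hT.smul hp c

theorem comp_mem_finiteRank {E' F' : Type*} [NormedAddCommGroup E'] [InnerProductSpace ℂ E']
    [CompleteSpace E'] [NormedAddCommGroup F'] [InnerProductSpace ℂ F'] [CompleteSpace F']
    {R : E →L[ℂ] F} (hR : R ∈ finiteRank E F) (S : F →L[ℂ] F') (T : E' →L[ℂ] E) :
    S ∘L R ∘L T ∈ finiteRank E' F' := by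
  induction hR using Submodule.span_induction with
  | mem R hR =>
    obtain ⟨x, y, rfl⟩ := hR
    rw [rankOne_comp, comp_rankOne]
    exact rankOne_mem_finiteRank _ _
  | zero => simp
  | add R R' _ _ hS hT =>
    rw [ContinuousLinearMap.add_comp, ContinuousLinearMap.comp_add]
    exact add_mem hS hT
  | smul c R _ hT =>
    rw [ContinuousLinearMap.smul_comp, ContinuousLinearMap.comp_smul]
    exact Submodule.smul_mem _ c hT

theorem exists_finiteRank_norm_sub_le {A : E →L[ℂ] F} (hA : IsCompactOperator A) {ε : ℝ}
    (hε : 0 < ε) : ∃ R ∈ finiteRank E F, ‖A - R‖ ≤ ε := by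
  obtain ⟨t, ht, hAt⟩ := Metric.totallyBounded_iff.1
    (isCompactOperator_iff_totallyBounded.1 hA) ε hε
  have := FiniteDimensional.span_of_finite ℂ ht
  set U := Submodule.span ℂ t with hU
  -- A is projected onto the span of a finite ε-net of the image of the unit ball; the projection is
  -- at least as close as the net point.
  refine ⟨U.starProjection ∘L A, ?_, ?_⟩
  · rw [(stdOrthonormalBasis ℂ U).starProjection_eq_sum_rankOne,
      ContinuousLinearMap.finsetSum_comp]
    refine sum_mem fun i _ => ?_
    rw [rankOne_comp]
    exact rankOne_mem_finiteRank _ _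
  · refine ContinuousLinearMap.opNorm_le_of_unit_norm hε.le fun x hx => ?_
    have hx' := hAt ⟨x, by simp [hx], rfl⟩
    simp only [Set.mem_iUnion, exists_prop] at hx'
    obtain ⟨y, hy, hxy⟩ := hx'
    rw [sub_apply, ContinuousLinearMap.comp_apply, U.starProjection_minimal]
    refine (ciInf_le ⟨0, by rintro _ ⟨z, rfl⟩; exact norm_nonneg _⟩
      (⟨y, Submodule.subset_span hy⟩ : U)).trans ?_
    rw [Metric.mem_ball, dist_eq_norm] at hxy
    exact hxy.le

theorem exists_finiteRank_schattenENorm_sub_le (hp : 1 ≤ p) {A : E →L[ℂ] F}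
    (hA : MemSchatten p A) {ε : ℝ} (hε : 0 < ε) :
    ∃ R ∈ finiteRank E F, schattenENorm p (A - R) ≤ ENNReal.ofReal ε := by
  classical
  have hc := hA.isCompactOperator hp
  by_cases hp' : p = ∞
  · subst hp'
    obtain ⟨R, hR, h⟩ := exists_finiteRank_norm_sub_le hc hε
    refine ⟨R, hR, ?_⟩
    rw [schattenENorm_top, ← ofReal_norm]
    exact ENNReal.ofReal_le_ofReal h
  have h1 := one_le_toReal hp hp'
  have h0 := toReal_pos_of_one_le hp hp'
  obtain ⟨s, b, hb⟩ := exists_isDiagonalizing hc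
  have hfin : ∑' i, ‖A (b i)‖ₑ ^ p.toReal ≠ ∞ := by
    have := hA.schattenENorm_lt_top hp
    rw [schattenENorm_of_ne_top hp', ENNReal.rpow_lt_top_iff_of_pos (by positivity),
      hb.schattenSup_eq h1] at this
    exact this.ne
  have hpos : 0 < ENNReal.ofReal ε ^ p.toReal :=
    ENNReal.rpow_pos (ENNReal.ofReal_pos.2 hε) ENNReal.ofReal_ne_top
  obtain ⟨t, ht⟩ := ((tendsto_tsum_truncate b A h0 hfin).eventually_le_const hpos).exists
  refine ⟨truncate b A t, sum_mem fun i _ => rankOne_mem_finiteRank _ _, ?_⟩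
  -- The remainder is diagonal in the same basis, so its norm is the tail of the convergent sum.
  have hd : IsDiagonalizing (A - truncate b A t) b := fun i j hij => by
    simp only [sub_apply, truncate_apply_self]
    split_ifs <;> simp [hb hij]
  rw [schattenENorm_le_iff hp hp', hd.schattenSup_eq h1]
  exact ht

/-! ### Duality -/

theorem memSchatten_of_schattenENorm_ne_top (hp : 1 ≤ p) (hp2 : p ≤ 2) {A : E →L[ℂ] F}
    (h : schattenENorm p A ≠ ∞) : MemSchatten p A :=
  (memSchatten_iff hp).2 ⟨isCompactOperator_of_schattenENorm_ne_top hp hp2 h, h.lt_top⟩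

/-- The Schatten norm of index `p` is bounded by the norm of the functional which it defines on
the operators of finite rank, with respect to the Schatten norm of the conjugate index `q`. -/
theorem schattenENorm_le_of_forall_finiteRank (hp : 1 ≤ p) (hp' : p ≠ ∞) (hq : 1 ≤ q)
    (hpq : p⁻¹ + q⁻¹ = 1) {A : E →L[ℂ] F} {C : ℝ} (hC : 0 ≤ C)
    (h : ∀ (n : ℕ) (c : Fin n → ℂ) (x : Fin n → E) (y : Fin n → F),
      (∑ j, c j * ⟪y j, A (x j)⟫_ℂ).re ≤
        C * (schattenENorm q (∑ j, c j • rankOne ℂ (x j) (y j))).toReal) :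
    schattenENorm p A ≤ ENNReal.ofReal C := by
  rw [schattenENorm_le_iff hp hp']
  refine schattenSup_le_iff.2 fun n x y hx hy => ?_
  have hp0 := toReal_pos_of_one_le hp hp'
  have hp1 := one_le_toReal hp hp'
  set t : Fin n → ℝ := fun j => ‖⟪y j, A (x j)⟫_ℂ‖ with ht
  have ht0 (j) : 0 ≤ t j := norm_nonneg _
  choose u hu1 hu2 using fun j => exists_phase ⟪y j, A (x j)⟫_ℂ
  set T := ∑ j, t j ^ p.toReal with hT
  have hT0 : 0 ≤ T := Finset.sum_nonneg fun j _ => by positivity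
  have hgoal : ∑ j, ‖⟪y j, A (x j)⟫_ℂ‖ₑ ^ p.toReal = ENNReal.ofReal T := by
    rw [hT, ENNReal.ofReal_sum_of_nonneg fun j _ => by positivity]
    refine Finset.sum_congr rfl fun j _ => ?_
    rw [← ENNReal.ofReal_rpow_of_nonneg (ht0 j) hp0.le, ht, ofReal_norm]
  rw [hgoal, ENNReal.ofReal_rpow_of_nonneg hC hp0.le]
  refine ENNReal.ofReal_le_ofReal ?_
  -- The equality case of Hölder: the coefficient tⱼ^(p-1) times the phase turns the left side into
  -- T = ∑ tⱼ^p.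
  have hsum := h n (fun j => (t j ^ (p.toReal - 1) : ℝ) * u j) x y
  have hlhs : (∑ j, ((t j ^ (p.toReal - 1) : ℝ) : ℂ) * u j * ⟪y j, A (x j)⟫_ℂ).re = T := by
    rw [hT, ← Complex.ofReal_re (∑ j, t j ^ p.toReal), Complex.ofReal_sum]
    congr 1
    refine Finset.sum_congr rfl fun j _ => ?_
    rw [mul_assoc, hu2, ← Complex.ofReal_mul]
    congr 1
    rcases (ht0 j).eq_or_lt with h0 | h0
    · rw [show ‖⟪y j, A (x j)⟫_ℂ‖ = t j from rfl, ← h0, mul_zero, Real.zero_rpow hp0.ne']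
    · rw [show ‖⟪y j, A (x j)⟫_ℂ‖ = t j from rfl, Real.rpow_sub_one h0.ne',
        div_mul_cancel₀ _ h0.ne']
  rw [hlhs] at hsum
  by_cases hq' : q = ∞
  · have hp1' : p = 1 := by simpa [hq'] using hpq
    subst hq' hp1'
    have hle : (schattenENorm ∞ (∑ j, (((t j ^ ((1 : ℝ≥0∞).toReal - 1) : ℝ) : ℂ) * u j) •
        rankOne ℂ (x j) (y j))).toReal ≤ 1 := by
      rw [schattenENorm_top]
      refine ENNReal.toReal_le_of_le_ofReal zero_le_one ?_
      rw [ENNReal.ofReal_one]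
      refine enorm_sum_smul_rankOne_le hx hy fun j => ?_
      rw [← ofReal_norm]
      exact ENNReal.ofReal_le_one.2 (by simpa using hu1 j)
    simp only [ENNReal.toReal_one, Real.rpow_one]
    exact hsum.trans (mul_le_of_le_one_right hC hle)
  have hconj := holderConjugate_toReal hp hq hp' hq' hpq
  have hq0 := toReal_pos_of_one_le hq hq'
  have hle : (schattenENorm q (∑ j, (((t j ^ (p.toReal - 1) : ℝ) : ℂ) * u j) •
      rankOne ℂ (x j) (y j))).toReal ≤ T ^ (1 / q.toReal) := by
    refine ENNReal.toReal_le_of_le_ofReal (by positivity) ?_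
    refine (schattenENorm_sum_smul_rankOne_le hq hq' _ hx hy).trans ?_
    rw [← ENNReal.ofReal_rpow_of_nonneg hT0 (by positivity)]
    gcongr
    rw [hT, ENNReal.ofReal_sum_of_nonneg fun j _ => by positivity]
    refine Finset.sum_le_sum fun j _ => ?_
    have h1 : ‖((t j ^ (p.toReal - 1) : ℝ) : ℂ) * u j‖ₑ ≤ ENNReal.ofReal (t j ^ (p.toReal - 1)) := by
      rw [← ofReal_norm]
      refine ENNReal.ofReal_le_ofReal ?_
      rw [norm_mul, Complex.norm_real, Real.norm_of_nonneg (by positivity)]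
      exact mul_le_of_le_one_right (by positivity) (hu1 j)
    refine (ENNReal.rpow_le_rpow h1 hq0.le).trans ?_
    rw [ENNReal.ofReal_rpow_of_nonneg (by positivity) hq0.le, ← Real.rpow_mul (ht0 j),
      hconj.sub_one_mul_conj]
  -- As (p-1)q = p, the test operator has norm at most T^(1/q); dividing leaves T^(1/p) ≤ C.
  have hfin : T ≤ C * T ^ (1 / q.toReal) := hsum.trans (by gcongr)
  rcases hT0.eq_or_lt with h0 | h0
  · rw [← h0]; positivity
  have h2 : T ^ (1 / p.toReal) ≤ C := by
    rw [← div_le_iff₀ (by positivity)] at hfin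
    refine le_trans (le_of_eq ?_) hfin
    nth_rewrite 2 [← Real.rpow_one T]
    rw [← Real.rpow_sub h0]
    congr 1
    have := hconj.inv_add_inv_eq_one
    rw [one_div, one_div]
    linarith
  calc T = (T ^ (1 / p.toReal)) ^ p.toReal := by
        rw [← Real.rpow_mul hT0, one_div_mul_cancel hp0.ne', Real.rpow_one]
    _ ≤ C ^ p.toReal := by gcongr

end Classes

section Blocks

open InnerProductSpace

variable {H : Type*} [NormedAddCommGroup H] [InnerProductSpace ℂ H] [CompleteSpace H]

/-! ### Blocks -/

section Block

variable (L K : Submodule ℂ H) [CompleteSpace L] [CompleteSpace K]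

theorem block_apply (A : H →L[ℂ] H) (x : K) :
    block L K A x = L.orthogonalProjectionOnto (A x) := rfl

theorem block_add (A B : H →L[ℂ] H) : block L K (A + B) = block L K A + block L K B := by
  ext x; simp [block_apply]

theorem block_smul (c : ℂ) (A : H →L[ℂ] H) : block L K (c • A) = c • block L K A := by
  ext x; simp [block_apply]

theorem block_sub (A B : H →L[ℂ] H) : block L K (A - B) = block L K A - block L K B := by
  ext x; simp [block_apply]

theorem block_neg (A : H →L[ℂ] H) : block L K (-A) = -block L K A := by
  ext x; simp [block_apply]

theorem block_adjoint (A : H →L[ℂ] H) : block L K A.adjoint = (block K L A).adjoint := by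
  simp only [block, ContinuousLinearMap.adjoint_comp, Submodule.adjoint_subtypeL,
    Submodule.adjoint_orthogonalProjectionOnto, ContinuousLinearMap.comp_assoc]

theorem block_rankOne (x y : H) : block L K (rankOne ℂ x y) =
    rankOne ℂ (L.orthogonalProjectionOnto x) (K.orthogonalProjectionOnto y) := by
  rw [block, rankOne_comp, comp_rankOne, Submodule.adjoint_subtypeL]

theorem enorm_block_le (A : H →L[ℂ] H) : ‖block L K A‖ₑ ≤ ‖A‖ₑ := by
  rw [← ofReal_norm, ← ofReal_norm]
  refine ENNReal.ofReal_le_ofReal ?_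
  refine ContinuousLinearMap.opNorm_le_bound _ (norm_nonneg _) fun x => ?_
  rw [block_apply]
  exact (L.norm_orthogonalProjectionOnto_apply_le _).trans (A.le_opNorm _)

theorem continuous_block : Continuous fun A : H →L[ℂ] H => block L K A := by
  unfold block
  fun_prop

end Block

variable (Hp : Submodule ℂ H) [CompleteSpace Hp]

/-- The identity pr₊ + pr₋ is inserted between the two factors. -/
theorem block_mul (L K : Submodule ℂ H) [CompleteSpace L] [CompleteSpace K] (A B : H →L[ℂ] H) :
    block L K (A * B) = block L Hp A ∘L block Hp K B + block L Hpᗮ A ∘L block Hpᗮ K B := by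
  ext x
  simp only [block_apply, add_apply, ContinuousLinearMap.comp_apply, mul_apply_eq_comp]
  rw [← map_add, ← map_add]
  simp only [Submodule.coe_orthogonalProjectionOnto_apply]
  rw [Submodule.starProjection_add_starProjection_orthogonal]

/-- The operator on `H` with a single block. -/
noncomputable def extend (L K : Submodule ℂ H) [CompleteSpace L] [CompleteSpace K]
    (T : K →L[ℂ] L) : H →L[ℂ] H := L.subtypeL ∘L T ∘L K.orthogonalProjectionOnto

theorem extend_block (L K : Submodule ℂ H) [CompleteSpace L] [CompleteSpace K] (A : H →L[ℂ] H) :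
    extend L K (block L K A) = L.starProjection * A * K.starProjection := rfl

theorem orthogonal_starProjection_eq : Hpᗮ.starProjection = 1 - Hp.starProjection :=
  Submodule.starProjection_orthogonal' Hp

theorem eq_sum_extend_block (A : H →L[ℂ] H) :
    A = extend Hp Hp (block Hp Hp A) + extend Hpᗮ Hpᗮ (block Hpᗮ Hpᗮ A) +
      extend Hp Hpᗮ (block Hp Hpᗮ A) + extend Hpᗮ Hp (block Hpᗮ Hp A) := by
  simp only [extend_block, orthogonal_starProjection_eq]
  noncomm_ring

/-- As d = i(2 pr₊ - 1), the commutator is 2i[pr₊, A], and in [pr₊, A] the diagonal blocks cancel.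
-/
theorem commD_eq (A : H →L[ℂ] H) : commD Hp A = (2 * Complex.I) •
    (extend Hp Hpᗮ (block Hp Hpᗮ A) - extend Hpᗮ Hp (block Hpᗮ Hp A)) := by
  have h : extend Hp Hpᗮ (block Hp Hpᗮ A) - extend Hpᗮ Hp (block Hpᗮ Hp A) =
      Hp.starProjection * A - A * Hp.starProjection := by
    simp only [extend_block, orthogonal_starProjection_eq]
    noncomm_ring
  rw [h, commD, d, orthogonal_starProjection_eq, smul_mul_assoc, mul_smul_comm, ← smul_sub,
    mul_comm, mul_smul]
  congr 1
  rw [two_smul]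
  noncomm_ring

theorem block_extend_self (L K : Submodule ℂ H) [CompleteSpace L] [CompleteSpace K]
    (T : K →L[ℂ] L) : block L K (extend L K T) = T := by
  ext x
  simp [block_apply, extend]

theorem block_extend_of_orthogonal_left {L L' : Submodule ℂ H} (K K' : Submodule ℂ H)
    [CompleteSpace L] [CompleteSpace K] [CompleteSpace L'] [CompleteSpace K']
    (h : L' ⟂ L) (T : K →L[ℂ] L) : block L' K' (extend L K T) = 0 := by
  ext x
  simp only [block_apply, extend, ContinuousLinearMap.comp_apply, Submodule.subtypeL_apply,
    zero_apply]
  rw [Submodule.orthogonalProjectionOnto_apply_of_mem_orthogonal]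
  exact h.symm (Subtype.mem _)

theorem block_extend_of_orthogonal_right {K K' : Submodule ℂ H} (L L' : Submodule ℂ H)
    [CompleteSpace L] [CompleteSpace K] [CompleteSpace L'] [CompleteSpace K']
    (h : K' ⟂ K) (T : K →L[ℂ] L) : block L' K' (extend L K T) = 0 := by
  ext x
  simp only [block_apply, extend, ContinuousLinearMap.comp_apply, Submodule.subtypeL_apply,
    zero_apply]
  rw [Submodule.orthogonalProjectionOnto_apply_of_mem_orthogonal (h (Subtype.mem x))]
  simp

theorem block_pm_commD (A : H →L[ℂ] H) :
    block Hp Hpᗮ (commD Hp A) = (2 * Complex.I) • block Hp Hpᗮ A := by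
  rw [commD_eq, block_smul, block_sub, block_extend_self,
    block_extend_of_orthogonal_left _ _ (Submodule.isOrtho_orthogonal_right Hp), sub_zero]

theorem block_mp_commD (A : H →L[ℂ] H) :
    block Hpᗮ Hp (commD Hp A) = (-(2 * Complex.I)) • block Hpᗮ Hp A := by
  rw [commD_eq, block_smul, block_sub, block_extend_self,
    block_extend_of_orthogonal_left _ _ (Submodule.isOrtho_orthogonal_left Hp), zero_sub, smul_neg,
    ← neg_smul]

variable {p q : ℝ≥0∞}

theorem enorm_subtypeL_le (L : Submodule ℂ H) : ‖L.subtypeL‖ₑ ≤ 1 := by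
  rw [← ofReal_norm]
  exact ENNReal.ofReal_le_one.2 L.norm_subtypeL_le

theorem enorm_orthogonalProjectionOnto_le (L : Submodule ℂ H) [CompleteSpace L] :
    ‖L.orthogonalProjectionOnto‖ₑ ≤ 1 := by
  rw [← ofReal_norm]
  exact ENNReal.ofReal_le_one.2 L.orthogonalProjectionOnto_norm_le

section Single

variable {L K : Submodule ℂ H} [CompleteSpace L] [CompleteSpace K]

theorem MemSchatten.block (hp : 1 ≤ p) {A : H →L[ℂ] H} (hA : MemSchatten p A) :
    MemSchatten p (block L K A) := (hA.comp_clm hp _).clm_comp hp _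

theorem MemSchatten.extend (hp : 1 ≤ p) {T : K →L[ℂ] L} (hT : MemSchatten p T) :
    MemSchatten p (extend L K T) := (hT.comp_clm hp _).clm_comp hp _

theorem schattenENorm_block_le (hp : 1 ≤ p) (A : H →L[ℂ] H) :
    schattenENorm p (block L K A) ≤ schattenENorm p A := by
  refine (schattenENorm_comp_le hp _ _).trans ?_
  refine (mul_le_of_le_one_left' (enorm_orthogonalProjectionOnto_le L)).trans ?_
  exact (schattenENorm_comp_le' hp _ _).trans (mul_le_of_le_one_right' (enorm_subtypeL_le K))

theorem enorm_extend_le (T : K →L[ℂ] L) : ‖extend L K T‖ₑ ≤ ‖T‖ₑ := by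
  refine (ContinuousLinearMap.opENorm_comp_le _ _).trans ?_
  refine (mul_le_of_le_one_left' (enorm_subtypeL_le L)).trans ?_
  exact (ContinuousLinearMap.opENorm_comp_le _ _).trans
    (mul_le_of_le_one_right' (enorm_orthogonalProjectionOnto_le K))

theorem extend_mem_finiteRank {T : K →L[ℂ] L} (hT : T ∈ finiteRank K L) :
    extend L K T ∈ finiteRank H H := comp_mem_finiteRank hT _ _

end Single

theorem memSchatten_commD_iff (hp : 1 ≤ p) {A : H →L[ℂ] H} : MemSchatten p (commD Hp A) ↔
    MemSchatten p (block Hp Hpᗮ A) ∧ MemSchatten p (block Hpᗮ Hp A) := by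
  have h2I : (2 * Complex.I : ℂ) ≠ 0 := by simp
  constructor
  · intro h
    have h1 : MemSchatten p (block Hp Hpᗮ (commD Hp A)) := h.block hp
    have h2 : MemSchatten p (block Hpᗮ Hp (commD Hp A)) := h.block hp
    rw [block_pm_commD] at h1
    rw [block_mp_commD] at h2
    have h1' := h1.smul hp (2 * Complex.I)⁻¹
    have h2' := h2.smul hp (-(2 * Complex.I))⁻¹
    rw [inv_smul_smul₀ h2I] at h1'
    rw [inv_smul_smul₀ (neg_ne_zero.2 h2I)] at h2'
    exact ⟨h1', h2'⟩
  · rintro ⟨h1, h2⟩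
    rw [commD_eq]
    exact ((h1.extend hp).sub hp (h2.extend hp)).smul hp _

theorem schattenENorm_block_pm_le (hp : 1 ≤ p) (A : H →L[ℂ] H) :
    schattenENorm p (block Hp Hpᗮ A) ≤ schattenENorm p (commD Hp A) := by
  refine le_trans ?_ (schattenENorm_block_le (L := Hp) (K := Hpᗮ) hp _)
  rw [block_pm_commD, schattenENorm_smul hp]
  -- The commutator multiplies the block by 2i, of modulus 2 ≥ 1.
  refine le_mul_of_one_le_left' ?_
  rw [← ofReal_norm, ENNReal.one_le_ofReal]
  simp

theorem schattenENorm_block_mp_le (hp : 1 ≤ p) (A : H →L[ℂ] H) :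
    schattenENorm p (block Hpᗮ Hp A) ≤ schattenENorm p (commD Hp A) := by
  refine le_trans ?_ (schattenENorm_block_le (L := Hpᗮ) (K := Hp) hp _)
  rw [block_mp_commD, schattenENorm_smul hp]
  refine le_mul_of_one_le_left' ?_
  rw [← ofReal_norm, ENNReal.one_le_ofReal]
  simp

/-! ### The spaces `L_{1,q}` and `L_{res,p}` -/

theorem mem_L1q_iff (hq : 1 ≤ q) {A : H →L[ℂ] H} : A ∈ L1q Hp q ↔
    MemSchatten 1 (block Hp Hp A) ∧ MemSchatten 1 (block Hpᗮ Hpᗮ A) ∧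
      MemSchatten q (block Hp Hpᗮ A) ∧ MemSchatten q (block Hpᗮ Hp A) := by
  rw [L1q, Set.mem_ofPred_eq, memSchatten_commD_iff Hp hq]
  tauto

/-- The norm of `L_{1,q}` with values in `[0, ∞]`. -/
noncomputable def enorm1q (q : ℝ≥0∞) (A : H →L[ℂ] H) : ℝ≥0∞ :=
  schattenENorm 1 (block Hp Hp A) + schattenENorm 1 (block Hpᗮ Hpᗮ A) +
    schattenENorm q (block Hp Hpᗮ A) + schattenENorm q (block Hpᗮ Hp A)

/-- The norm of `L_{res,p}` with values in `[0, ∞]`. -/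
noncomputable def enormRes (p : ℝ≥0∞) (A : H →L[ℂ] H) : ℝ≥0∞ :=
  ‖A‖ₑ + schattenENorm p (commD Hp A)

theorem enorm1q_ne_top (hq : 1 ≤ q) {A : H →L[ℂ] H} (hA : A ∈ L1q Hp q) :
    enorm1q Hp q A ≠ ∞ := by
  rw [mem_L1q_iff Hp hq] at hA
  have h1 := (hA.1.schattenENorm_lt_top le_rfl).ne
  have h2 := (hA.2.1.schattenENorm_lt_top le_rfl).ne
  have h3 := (hA.2.2.1.schattenENorm_lt_top hq).ne
  have h4 := (hA.2.2.2.schattenENorm_lt_top hq).ne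
  rw [enorm1q]
  finiteness

theorem norm1q_eq (hq : 1 ≤ q) {A : H →L[ℂ] H} (hA : A ∈ L1q Hp q) :
    norm1q Hp q A = (enorm1q Hp q A).toReal := by
  rw [mem_L1q_iff Hp hq] at hA
  have h1 := (hA.1.schattenENorm_lt_top le_rfl).ne
  have h2 := (hA.2.1.schattenENorm_lt_top le_rfl).ne
  have h3 := (hA.2.2.1.schattenENorm_lt_top hq).ne
  have h4 := (hA.2.2.2.schattenENorm_lt_top hq).ne
  rw [enorm1q, ENNReal.toReal_add (by finiteness) h4, ENNReal.toReal_add (by finiteness) h3,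
    ENNReal.toReal_add h1 h2, norm1q, hA.1.schattenNorm_eq le_rfl, hA.2.1.schattenNorm_eq le_rfl,
    hA.2.2.1.schattenNorm_eq hq, hA.2.2.2.schattenNorm_eq hq]

theorem enormRes_ne_top (hp : 1 ≤ p) {A : H →L[ℂ] H} (hA : A ∈ Lres Hp p) :
    enormRes Hp p A ≠ ∞ :=
  ENNReal.add_ne_top.2 ⟨enorm_ne_top, (MemSchatten.schattenENorm_lt_top hp hA).ne⟩

theorem normRes_eq (hp : 1 ≤ p) {A : H →L[ℂ] H} (hA : A ∈ Lres Hp p) :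
    normRes Hp p A = (enormRes Hp p A).toReal := by
  rw [normRes, enormRes, ENNReal.toReal_add enorm_ne_top (MemSchatten.schattenENorm_lt_top hp hA).ne,
    toReal_enorm, MemSchatten.schattenNorm_eq hp hA]

theorem enorm1q_add_le (hq : 1 ≤ q) (A B : H →L[ℂ] H) :
    enorm1q Hp q (A + B) ≤ enorm1q Hp q A + enorm1q Hp q B := by
  simp only [enorm1q, block_add]
  calc _ ≤ _ := add_le_add (add_le_add (add_le_add (schattenENorm_add_le le_rfl _ _)
        (schattenENorm_add_le le_rfl _ _)) (schattenENorm_add_le hq _ _))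
        (schattenENorm_add_le hq _ _)
    _ = _ := by abel

theorem enorm1q_smul (hq : 1 ≤ q) (c : ℂ) (A : H →L[ℂ] H) :
    enorm1q Hp q (c • A) = ‖c‖ₑ * enorm1q Hp q A := by
  simp only [enorm1q, block_smul, schattenENorm_smul le_rfl, schattenENorm_smul hq, mul_add]

theorem enorm1q_adjoint (hq : 1 ≤ q) (A : H →L[ℂ] H) :
    enorm1q Hp q A.adjoint = enorm1q Hp q A := by
  simp only [enorm1q, block_adjoint, schattenENorm_adjoint le_rfl, schattenENorm_adjoint hq]
  abel

theorem enorm_le_enorm1q (hq : 1 ≤ q) (A : H →L[ℂ] H) : ‖A‖ₑ ≤ enorm1q Hp q A := by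
  conv_lhs => rw [eq_sum_extend_block Hp A]
  have h {L K : Submodule ℂ H} [CompleteSpace L] [CompleteSpace K] {r : ℝ≥0∞} (hr : 1 ≤ r) :
      ‖extend L K (block L K A)‖ₑ ≤ schattenENorm r (block L K A) :=
    (enorm_extend_le _).trans (enorm_le_schattenENorm hr _)
  refine (enorm_add_le _ _).trans (add_le_add ((enorm_add_le _ _).trans (add_le_add
    ((enorm_add_le _ _).trans (add_le_add ?_ ?_)) ?_)) ?_)
  exacts [h le_rfl, h le_rfl, h hq, h hq]

theorem commD_add (A B : H →L[ℂ] H) : commD Hp (A + B) = commD Hp A + commD Hp B := by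
  simp only [commD]; noncomm_ring

theorem commD_smul (c : ℂ) (A : H →L[ℂ] H) : commD Hp (c • A) = c • commD Hp A := by
  simp only [commD, mul_smul_comm, smul_mul_assoc, smul_sub]

theorem enormRes_add_le (hp : 1 ≤ p) (A B : H →L[ℂ] H) :
    enormRes Hp p (A + B) ≤ enormRes Hp p A + enormRes Hp p B := by
  simp only [enormRes, commD_add]
  calc _ ≤ _ := add_le_add (enorm_add_le _ _) (schattenENorm_add_le hp _ _)
    _ = _ := by abel

theorem enormRes_smul (hp : 1 ≤ p) (c : ℂ) (A : H →L[ℂ] H) :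
    enormRes Hp p (c • A) = ‖c‖ₑ * enormRes Hp p A := by
  simp only [enormRes, commD_smul, enorm_smul, schattenENorm_smul hp, mul_add]

theorem L1q_add (hq : 1 ≤ q) {A B : H →L[ℂ] H} (hA : A ∈ L1q Hp q) (hB : B ∈ L1q Hp q) :
    A + B ∈ L1q Hp q := by
  rw [mem_L1q_iff Hp hq] at *
  simp only [block_add]
  exact ⟨hA.1.add le_rfl hB.1, hA.2.1.add le_rfl hB.2.1, hA.2.2.1.add hq hB.2.2.1,
    hA.2.2.2.add hq hB.2.2.2⟩

theorem L1q_smul (hq : 1 ≤ q) (c : ℂ) {A : H →L[ℂ] H} (hA : A ∈ L1q Hp q) :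
    c • A ∈ L1q Hp q := by
  rw [mem_L1q_iff Hp hq] at *
  simp only [block_smul]
  exact ⟨hA.1.smul le_rfl c, hA.2.1.smul le_rfl c, hA.2.2.1.smul hq c, hA.2.2.2.smul hq c⟩

theorem L1q_of_mem_finiteRank (hq : 1 ≤ q) {R : H →L[ℂ] H} (hR : R ∈ finiteRank H H) :
    R ∈ L1q Hp q := by
  rw [mem_L1q_iff Hp hq]
  exact ⟨(memSchatten_of_mem_finiteRank le_rfl hR).block le_rfl,
    (memSchatten_of_mem_finiteRank le_rfl hR).block le_rfl,
    (memSchatten_of_mem_finiteRank hq hR).block hq, (memSchatten_of_mem_finiteRank hq hR).block hq⟩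

/-- Each block is approximated within ε/4. For q = ∞ this is possible because L_∞ consists of
compact operators only. -/
theorem exists_finiteRank_enorm1q_sub_le (hq : 1 ≤ q) {A : H →L[ℂ] H} (hA : A ∈ L1q Hp q) {ε : ℝ}
    (hε : 0 < ε) : ∃ R ∈ finiteRank H H, enorm1q Hp q (A - R) ≤ ENNReal.ofReal ε := by
  rw [mem_L1q_iff Hp hq] at hA
  have hε' : 0 < ε / 4 := by positivity
  obtain ⟨R₁, h₁, h₁'⟩ := exists_finiteRank_schattenENorm_sub_le le_rfl hA.1 hε'
  obtain ⟨R₂, h₂, h₂'⟩ := exists_finiteRank_schattenENorm_sub_le le_rfl hA.2.1 hε'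
  obtain ⟨R₃, h₃, h₃'⟩ := exists_finiteRank_schattenENorm_sub_le hq hA.2.2.1 hε'
  obtain ⟨R₄, h₄, h₄'⟩ := exists_finiteRank_schattenENorm_sub_le hq hA.2.2.2 hε'
  refine ⟨extend Hp Hp R₁ + extend Hpᗮ Hpᗮ R₂ + extend Hp Hpᗮ R₃ + extend Hpᗮ Hp R₄,
    add_mem (add_mem (add_mem (extend_mem_finiteRank h₁) (extend_mem_finiteRank h₂))
      (extend_mem_finiteRank h₃)) (extend_mem_finiteRank h₄), ?_⟩
  have o1 : Hp ⟂ Hpᗮ := Submodule.isOrtho_orthogonal_right Hp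
  have o2 : Hpᗮ ⟂ Hp := Submodule.isOrtho_orthogonal_left Hp
  simp only [enorm1q, block_sub, block_add, block_extend_self,
    block_extend_of_orthogonal_left _ _ o1, block_extend_of_orthogonal_left _ _ o2,
    block_extend_of_orthogonal_right _ _ o1, block_extend_of_orthogonal_right _ _ o2,
    add_zero, zero_add]
  refine (add_le_add (add_le_add (add_le_add h₁' h₂') h₃') h₄').trans (le_of_eq ?_)
  rw [← ENNReal.ofReal_add hε'.le hε'.le, ← ENNReal.ofReal_add (by positivity) hε'.le,
    ← ENNReal.ofReal_add (by positivity) hε'.le]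
  congr 1
  ring

/-! ### The pairing -/

/-- Hölder is needed in the diagonal blocks only, for L_p · L_q ⊆ L_1; off the diagonal, L_1 ⊆ L_q
and the ideal property suffice. -/
theorem mul_mem_L1q (hp : 1 ≤ p) (hq : 1 ≤ q) (hpq : p⁻¹ + q⁻¹ = 1) {a ρ : H →L[ℂ] H}
    (ha : a ∈ Lres Hp p) (hρ : ρ ∈ L1q Hp q) : a * ρ ∈ L1q Hp q := by
  have ha' := (memSchatten_commD_iff Hp hp).1 ha
  rw [mem_L1q_iff Hp hq] at *
  simp only [block_mul Hp]
  refine ⟨(hρ.1.clm_comp le_rfl _).add le_rfl (ha'.1.comp hp hq hpq hρ.2.2.2),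
    (ha'.2.comp hp hq hpq hρ.2.2.1).add le_rfl (hρ.2.1.clm_comp le_rfl _),
    (hρ.2.2.1.clm_comp hq _).add hq ((hρ.2.1.mono le_rfl hq).clm_comp hq _),
    ((hρ.1.mono le_rfl hq).clm_comp hq _).add hq (hρ.2.2.2.clm_comp hq _)⟩

theorem enorm_trRes_mul_le (hp : 1 ≤ p) (hq : 1 ≤ q) (hpq : p⁻¹ + q⁻¹ = 1) {a ρ : H →L[ℂ] H}
    (ha : a ∈ Lres Hp p) (hρ : ρ ∈ L1q Hp q) :
    ‖trRes Hp (a * ρ)‖ₑ ≤ enormRes Hp p a * enorm1q Hp q ρ := by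
  have ha' := (memSchatten_commD_iff Hp hp).1 ha
  rw [mem_L1q_iff Hp hq] at hρ
  have h1 : schattenENorm 1 (block Hp Hp (a * ρ)) ≤ ‖a‖ₑ * schattenENorm 1 (block Hp Hp ρ) +
      schattenENorm p (commD Hp a) * schattenENorm q (block Hpᗮ Hp ρ) := by
    rw [block_mul Hp]
    refine (schattenENorm_add_le le_rfl _ _).trans (add_le_add ?_ ?_)
    · refine (schattenENorm_comp_le le_rfl _ _).trans ?_
      gcongr
      exact enorm_block_le _ _ _
    · refine (schattenENorm_comp_le_mul hp hq hpq (ha'.1.isCompactOperator hp)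
        (hρ.2.2.2.isCompactOperator hq)).trans ?_
      gcongr
      exact schattenENorm_block_pm_le Hp hp a
  have h2 : schattenENorm 1 (block Hpᗮ Hpᗮ (a * ρ)) ≤
      schattenENorm p (commD Hp a) * schattenENorm q (block Hp Hpᗮ ρ) +
      ‖a‖ₑ * schattenENorm 1 (block Hpᗮ Hpᗮ ρ) := by
    rw [block_mul Hp]
    refine (schattenENorm_add_le le_rfl _ _).trans (add_le_add ?_ ?_)
    · refine (schattenENorm_comp_le_mul hp hq hpq (ha'.2.isCompactOperator hp)
        (hρ.2.2.1.isCompactOperator hq)).trans ?_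
      gcongr
      exact schattenENorm_block_mp_le Hp hp a
    · refine (schattenENorm_comp_le le_rfl _ _).trans ?_
      gcongr
      exact enorm_block_le _ _ _
  calc ‖trRes Hp (a * ρ)‖ₑ
      ≤ schattenENorm 1 (block Hp Hp (a * ρ)) + schattenENorm 1 (block Hpᗮ Hpᗮ (a * ρ)) :=
        (enorm_add_le _ _).trans (add_le_add (enorm_trace_le _) (enorm_trace_le _))
    _ ≤ _ := add_le_add h1 h2
    _ ≤ _ := by
        simp only [enormRes, enorm1q]
        set x := ‖a‖ₑ
        set y := schattenENorm p (commD Hp a)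
        set r := schattenENorm 1 (block Hp Hp ρ)
        set s := schattenENorm 1 (block Hpᗮ Hpᗮ ρ)
        set t := schattenENorm q (block Hp Hpᗮ ρ)
        set u := schattenENorm q (block Hpᗮ Hp ρ)
        have : (x + y) * (r + s + t + u) =
            (x * r + y * u + (y * t + x * s)) + (x * (t + u) + y * (r + s)) := by ring
        rw [this]
        exact le_self_add

theorem trRes_add (hq : 1 ≤ q) {A B : H →L[ℂ] H} (hA : A ∈ L1q Hp q) (hB : B ∈ L1q Hp q) :
    trRes Hp (A + B) = trRes Hp A + trRes Hp B := by
  rw [mem_L1q_iff Hp hq] at hA hB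
  simp only [trRes, block_add, trace_add hA.1 hB.1, trace_add hA.2.1 hB.2.1]
  ring

theorem trRes_smul (c : ℂ) (A : H →L[ℂ] H) : trRes Hp (c • A) = c * trRes Hp A := by
  simp only [trRes, block_smul, trace_smul, mul_add]

/-- The traces of the two diagonal blocks are the inner products of the components in H₊ and H₋. -/
theorem trRes_rankOne (x y : H) : trRes Hp (rankOne ℂ x y) = ⟪y, x⟫_ℂ := by
  simp only [trRes, block_rankOne, trace_rankOne, Submodule.coe_inner]
  conv_rhs => rw [← Submodule.starProjection_add_starProjection_orthogonal (K := Hp) y,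
    ← Submodule.starProjection_add_starProjection_orthogonal (K := Hp) x]
  simp only [Submodule.coe_orthogonalProjectionOnto_apply, inner_add_left, inner_add_right]
  have h1 (u v : H) : ⟪Hp.starProjection u, Hpᗮ.starProjection v⟫_ℂ = 0 :=
    Submodule.inner_right_of_mem_orthogonal (Hp.starProjection_apply_mem u)
      (Hpᗮ.starProjection_apply_mem v)
  have h2 (u v : H) : ⟪Hpᗮ.starProjection u, Hp.starProjection v⟫_ℂ = 0 :=
    Submodule.inner_left_of_mem_orthogonal (Hp.starProjection_apply_mem v)
      (Hpᗮ.starProjection_apply_mem u)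
  rw [h1, h2, add_zero, zero_add]

end Blocks

/-! ### Criteria for normed subspaces -/

section NormedSubset

/-- Estimates in [0, ∞] hold for all bounded operators without any membership condition; finiteness
on S brings them back to real norms. -/
theorem IsNormedSubspace.of_enorm {V : Type*} [AddCommGroup V] [Module ℝ V] {S : Set V} {N : V → ℝ}
    (eN : V → ℝ≥0∞) (h0 : (0 : V) ∈ S) (hadd : ∀ {x y : V}, x ∈ S → y ∈ S → x + y ∈ S)
    (hsmul : ∀ (c : ℝ) {x : V}, x ∈ S → c • x ∈ S) (hN : ∀ {x : V}, x ∈ S → N x = (eN x).toReal)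
    (hfin : ∀ {x : V}, x ∈ S → eN x ≠ ∞) (headd : ∀ x y, eN (x + y) ≤ eN x + eN y)
    (hesmul : ∀ (c : ℝ) x, eN (c • x) = ‖c‖ₑ * eN x) (hzero : ∀ x, eN x = 0 → x = 0) :
    IsNormedSubspace S N where
  zero_mem := h0
  add_mem := hadd
  smul_mem := hsmul
  norm_nonneg hx := by rw [hN hx]; exact ENNReal.toReal_nonneg
  norm_smul c x hx := by
    rw [hN hx, hN (hsmul c hx), hesmul, ENNReal.toReal_mul, toReal_enorm, Real.norm_eq_abs]
  norm_add_le hx hy := by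
    rw [hN hx, hN hy, hN (hadd hx hy), ← ENNReal.toReal_add (hfin hx) (hfin hy)]
    exact ENNReal.toReal_mono (ENNReal.add_ne_top.2 ⟨hfin hx, hfin hy⟩) (headd _ _)
  eq_zero_of_norm hx h := by
    rw [hN hx, ENNReal.toReal_eq_zero_iff] at h
    exact hzero _ (h.resolve_right (hfin hx))

/-- A normed subspace of a Banach space is complete, if its norm dominates the given one, and
bounded sequences which converge in the Banach space have their limit in the subspace, with a bound
on its norm. -/
theorem IsNormedSubspace.completeSpace {V : Type*} [NormedAddCommGroup V] [NormedSpace ℝ V]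
    [CompleteSpace V] {S : Set V} {N : V → ℝ} (h : IsNormedSubspace S N)
    (hle : ∀ x ∈ S, ‖x‖ ≤ N x) {K : ℝ} (hK : 0 < K)
    (hlim : ∀ (x : ℕ → V) (y : V) (C : ℝ), (∀ n, x n ∈ S) → (∀ n, N (x n) ≤ C) →
      Filter.Tendsto x Filter.atTop (nhds y) → y ∈ S ∧ N y ≤ K * C) : CompleteSpace h.Space := by
  refine Metric.complete_of_cauchySeq_tendsto fun u hu => ?_
  have hnorm (x : h.Space) : ‖x‖ = N x.val := rfl
  have hsub (x y : h.Space) : (x - y).val = x.val - y.val := rfl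
  have hmem (x : h.Space) : x.val ∈ S := x.2
  have hcau : CauchySeq fun n => (u n).val := by
    rw [Metric.cauchySeq_iff] at hu ⊢
    intro ε hε
    obtain ⟨n, hn⟩ := hu ε hε
    refine ⟨n, fun m hm k hk => lt_of_le_of_lt ?_ (hn m hm k hk)⟩
    rw [dist_eq_norm, dist_eq_norm, hnorm, hsub]
    exact hle _ (hmem (u m - u k))
  obtain ⟨y, hy⟩ := cauchySeq_tendsto_of_complete hcau
  -- The limit hypothesis is applied to the differences u_{k+n} - u_m, bounded by ε, as k tends to
  -- infinity.
  have key : ∀ ε > 0, ∃ n, ∀ m ≥ n, y - (u m).val ∈ S ∧ N (y - (u m).val) ≤ K * ε := by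
    intro ε hε
    obtain ⟨n, hn⟩ := Metric.cauchySeq_iff.1 hu ε hε
    refine ⟨n, fun m hm => hlim (fun k => (u (k + n)).val - (u m).val) _ ε (fun k => ?_)
      (fun k => ?_) ?_⟩
    · exact hmem (u (k + n) - u m)
    · have := hn (k + n) (Nat.le_add_left _ _) m hm
      rw [dist_eq_norm, hnorm, hsub] at this
      exact this.le
    · exact ((Filter.tendsto_add_atTop_iff_nat n).2 hy).sub_const _
  obtain ⟨n, hn⟩ := key 1 one_pos
  have hyS : y ∈ S := by
    have := h.add_mem (hn n le_rfl).1 (hmem (u n))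
    rwa [sub_add_cancel] at this
  let Y : h.Space := (⟨y, hyS⟩ : h.toSubmodule)
  refine ⟨Y, Metric.tendsto_atTop.2 fun ε hε => ?_⟩
  obtain ⟨n, hn⟩ := key (ε / (2 * K)) (by positivity)
  refine ⟨n, fun m hm => ?_⟩
  rw [dist_comm, dist_eq_norm, hnorm]
  refine lt_of_le_of_lt (hn m hm).2 ?_
  rw [mul_div_assoc', mul_comm, mul_div_mul_right _ _ hK.ne']
  exact half_lt_self hε

end NormedSubset

/-! ### The Banach spaces 𝔲_{1,q} and 𝔲_{res,p} -/

section Restricted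

open InnerProductSpace

variable {H : Type*} [NormedAddCommGroup H] [InnerProductSpace ℂ H] [CompleteSpace H]

theorem real_smul_eq (c : ℝ) (A : H →L[ℂ] H) : c • A = (c : ℂ) • A := by
  ext x; simp

theorem enorm_ofReal (c : ℝ) : ‖(c : ℂ)‖ₑ = ‖c‖ₑ := by
  rw [← ofReal_norm, ← ofReal_norm, Complex.norm_real]

theorem skewHermitian_add {A B : H →L[ℂ] H} (hA : A ∈ skewHermitian H) (hB : B ∈ skewHermitian H) :
    A + B ∈ skewHermitian H := by
  simp only [skewHermitian, Set.mem_ofPred_eq] at *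
  rw [map_add, hA, hB, neg_add]

theorem skewHermitian_smul (c : ℝ) {A : H →L[ℂ] H} (hA : A ∈ skewHermitian H) :
    c • A ∈ skewHermitian H := by
  simp only [skewHermitian, Set.mem_ofPred_eq] at *
  rw [real_smul_eq, map_smulₛₗ, hA, Complex.conj_ofReal, smul_neg]

theorem skewHermitian_zero : (0 : H →L[ℂ] H) ∈ skewHermitian H := by
  simp [skewHermitian]

theorem skewHermitian_of_tendsto {A : ℕ → H →L[ℂ] H} {B : H →L[ℂ] H}
    (hA : ∀ n, A n ∈ skewHermitian H) (h : Filter.Tendsto A Filter.atTop (nhds B)) :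
    B ∈ skewHermitian H := by
  have hc : IsClosed (skewHermitian H) := isClosed_eq
    (ContinuousLinearMap.adjoint (𝕜 := ℂ) (E := H) (F := H)).continuous continuous_neg
  exact hc.mem_of_tendsto h (.of_forall hA)

variable (Hp : Submodule ℂ H) [CompleteSpace Hp] {p q : ℝ≥0∞}

theorem isNormedSubspace_u1q (hq : 1 ≤ q) : IsNormedSubspace (u1q Hp q) (norm1q Hp q) := by
  refine .of_enorm (enorm1q Hp q) ⟨skewHermitian_zero, ?_⟩ ?_ ?_ ?_ ?_ ?_ ?_ ?_
  · exact L1q_of_mem_finiteRank Hp hq (zero_mem _)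
  · exact fun hx hy => ⟨skewHermitian_add hx.1 hy.1, L1q_add Hp hq hx.2 hy.2⟩
  · intro c x hx
    refine ⟨skewHermitian_smul c hx.1, ?_⟩
    rw [real_smul_eq]
    exact L1q_smul Hp hq c hx.2
  · exact fun hx => norm1q_eq Hp hq hx.2
  · exact fun hx => enorm1q_ne_top Hp hq hx.2
  · exact enorm1q_add_le Hp hq
  · intro c x
    rw [real_smul_eq, enorm1q_smul Hp hq, enorm_ofReal]
  · intro x hx
    have h := enorm_le_enorm1q Hp hq x
    rw [hx] at h
    simpa using h

theorem isNormedSubspace_uRes (hp : 1 ≤ p) : IsNormedSubspace (uRes Hp p) (normRes Hp p) := by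
  refine .of_enorm (enormRes Hp p) ⟨skewHermitian_zero, ?_⟩ ?_ ?_ ?_ ?_ ?_ ?_ ?_
  · change MemSchatten p (commD Hp 0)
    simpa [commD] using MemSchatten.zero hp
  · refine fun {x y} hx hy => ⟨skewHermitian_add hx.1 hy.1, ?_⟩
    change MemSchatten p (commD Hp (x + y))
    rw [commD_add]
    exact MemSchatten.add hp hx.2 hy.2
  · intro c x hx
    refine ⟨skewHermitian_smul c hx.1, ?_⟩
    change MemSchatten p (commD Hp (c • x))
    rw [real_smul_eq, commD_smul]
    exact MemSchatten.smul hp c hx.2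
  · exact fun hx => normRes_eq Hp hp hx.2
  · exact fun hx => enormRes_ne_top Hp hp hx.2
  · exact enormRes_add_le Hp hp
  · intro c x
    rw [real_smul_eq, enormRes_smul Hp hp, enorm_ofReal]
  · intro x hx
    simpa using (add_eq_zero.1 hx).1

theorem completeSpace_u1q (hq : 1 ≤ q) : CompleteSpace (isNormedSubspace_u1q Hp hq).Space := by
  -- Semicontinuity is applied to the four blocks separately, each bounded by C; hence the constant
  -- 4.
  refine (isNormedSubspace_u1q Hp hq).completeSpace (fun x hx => ?_) (K := 4) (by norm_num) ?_
  · rw [norm1q_eq Hp hq hx.2, ← toReal_enorm]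
    exact ENNReal.toReal_mono (enorm1q_ne_top Hp hq hx.2) (enorm_le_enorm1q Hp hq x)
  · intro x y C hx hC h
    have hC0 : 0 ≤ C := ((isNormedSubspace_u1q Hp hq).norm_nonneg (hx 0)).trans (hC 0)
    have hb (n) : enorm1q Hp q (x n) ≤ ENNReal.ofReal C := by
      rw [← ENNReal.ofReal_toReal (enorm1q_ne_top Hp hq (hx n).2), ← norm1q_eq Hp hq (hx n).2]
      exact ENNReal.ofReal_le_ofReal (hC n)
    have hmem (n) := (mem_L1q_iff Hp hq).1 (hx n).2
    have ht (L K : Submodule ℂ H) [CompleteSpace L] [CompleteSpace K] :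
        Filter.Tendsto (fun n => block L K (x n)) Filter.atTop (nhds (block L K y)) :=
      (continuous_block L K).continuousAt.tendsto.comp h
    have b1 (n) : schattenENorm 1 (block Hp Hp (x n)) ≤ ENNReal.ofReal C :=
      le_trans (by rw [enorm1q, add_assoc, add_assoc]; exact le_self_add) (hb n)
    have b2 (n) : schattenENorm 1 (block Hpᗮ Hpᗮ (x n)) ≤ ENNReal.ofReal C :=
      le_trans (by
        rw [enorm1q, add_assoc, add_comm (schattenENorm 1 (block Hp Hp (x n))), add_assoc]
        exact le_self_add) (hb n)
    have b3 (n) : schattenENorm q (block Hp Hpᗮ (x n)) ≤ ENNReal.ofReal C :=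
      le_trans (by
        rw [enorm1q, add_right_comm]
        exact le_add_self) (hb n)
    have b4 (n) : schattenENorm q (block Hpᗮ Hp (x n)) ≤ ENNReal.ofReal C :=
      le_trans (by rw [enorm1q]; exact le_add_self) (hb n)
    have hy : y ∈ L1q Hp q := (mem_L1q_iff Hp hq).2
      ⟨memSchatten_of_tendsto le_rfl (ht _ _) ENNReal.ofReal_ne_top (fun n => (hmem n).1) b1,
        memSchatten_of_tendsto le_rfl (ht _ _) ENNReal.ofReal_ne_top (fun n => (hmem n).2.1) b2,
        memSchatten_of_tendsto hq (ht _ _) ENNReal.ofReal_ne_top (fun n => (hmem n).2.2.1) b3,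
        memSchatten_of_tendsto hq (ht _ _) ENNReal.ofReal_ne_top (fun n => (hmem n).2.2.2) b4⟩
    refine ⟨⟨skewHermitian_of_tendsto (fun n => (hx n).1) h, hy⟩, ?_⟩
    rw [norm1q_eq Hp hq hy]
    refine ENNReal.toReal_le_of_le_ofReal (by positivity) ?_
    refine (add_le_add (add_le_add (add_le_add
      (schattenENorm_le_of_tendsto le_rfl (ht _ _) (.of_forall b1))
      (schattenENorm_le_of_tendsto le_rfl (ht _ _) (.of_forall b2)))
      (schattenENorm_le_of_tendsto hq (ht _ _) (.of_forall b3)))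
      (schattenENorm_le_of_tendsto hq (ht _ _) (.of_forall b4))).trans (le_of_eq ?_)
    rw [← ENNReal.ofReal_add hC0 hC0, ← ENNReal.ofReal_add (by positivity) hC0,
      ← ENNReal.ofReal_add (by positivity) hC0]
    congr 1
    ring

theorem continuous_commD : Continuous fun A : H →L[ℂ] H => commD Hp A := by
  unfold commD
  fun_prop

theorem completeSpace_uRes (hp : 1 ≤ p) : CompleteSpace (isNormedSubspace_uRes Hp hp).Space := by
  -- The two summands of the norm are each bounded by C; hence the constant 2.
  refine (isNormedSubspace_uRes Hp hp).completeSpace (fun x hx => ?_) (K := 2) (by norm_num) ?_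
  · rw [normRes_eq Hp hp hx.2, ← toReal_enorm]
    exact ENNReal.toReal_mono (enormRes_ne_top Hp hp hx.2) le_self_add
  · intro x y C hx hC h
    have hC0 : 0 ≤ C := ((isNormedSubspace_uRes Hp hp).norm_nonneg (hx 0)).trans (hC 0)
    have hb (n) : enormRes Hp p (x n) ≤ ENNReal.ofReal C := by
      rw [← ENNReal.ofReal_toReal (enormRes_ne_top Hp hp (hx n).2), ← normRes_eq Hp hp (hx n).2]
      exact ENNReal.ofReal_le_ofReal (hC n)
    have ht : Filter.Tendsto (fun n => commD Hp (x n)) Filter.atTop (nhds (commD Hp y)) :=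
      (continuous_commD Hp).continuousAt.tendsto.comp h
    have b (n) : schattenENorm p (commD Hp (x n)) ≤ ENNReal.ofReal C := le_add_self.trans (hb n)
    have hy : y ∈ Lres Hp p :=
      memSchatten_of_tendsto hp ht ENNReal.ofReal_ne_top (fun n => (hx n).2) b
    refine ⟨⟨skewHermitian_of_tendsto (fun n => (hx n).1) h, hy⟩, ?_⟩
    rw [normRes_eq Hp hp hy]
    refine ENNReal.toReal_le_of_le_ofReal (by positivity) ?_
    refine (add_le_add (le_of_tendsto (continuous_enorm.continuousAt.tendsto.comp h)
      (.of_forall fun n => le_self_add.trans (hb n)))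
      (schattenENorm_le_of_tendsto hp ht (.of_forall b))).trans (le_of_eq ?_)
    rw [← ENNReal.ofReal_add hC0 hC0]
    congr 1
    ring

/-! ### Skew-Hermitian operators of rank two -/

/-- The skew-Hermitian operator `z w* - w z*`. -/
noncomputable def skewRank (z w : H) : H →L[ℂ] H := rankOne ℂ z w - rankOne ℂ w z

theorem skewRank_mem_skewHermitian (z w : H) : skewRank z w ∈ skewHermitian H := by
  simp [skewHermitian, skewRank]

theorem skewRank_mem_u1q (hq : 1 ≤ q) (z w : H) : skewRank z w ∈ u1q Hp q :=
  ⟨skewRank_mem_skewHermitian z w, L1q_of_mem_finiteRank Hp hq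
    (sub_mem (rankOne_mem_finiteRank z w) (rankOne_mem_finiteRank w z))⟩

/-- The map R ↦ R - R* is only real linear, so the complex scalar c is carried through the induction
and absorbed by the first vector. -/
theorem sub_adjoint_mem_span {R : H →L[ℂ] H} (hR : R ∈ finiteRank H H) (c : ℂ) :
    c • R - (c • R).adjoint ∈ Submodule.span ℝ {T : H →L[ℂ] H | ∃ z w, T = skewRank z w} := by
  induction hR using Submodule.span_induction generalizing c with
  | mem R hR =>
    obtain ⟨x, y, rfl⟩ := hR
    refine Submodule.subset_span ⟨c • x, y, ?_⟩
    simp [skewRank, map_smulₛₗ ContinuousLinearMap.adjoint]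
  | zero => simp
  | add R S _ _ hR hS =>
    have : c • (R + S) - (c • (R + S)).adjoint =
        (c • R - (c • R).adjoint) + (c • S - (c • S).adjoint) := by
      rw [smul_add, map_add]; abel
    rw [this]
    exact add_mem (hR c) (hS c)
  | smul c' R _ hR =>
    rw [smul_smul]
    exact hR (c * c')

/-- A finite rank approximation is replaced by its skew-Hermitian part; the norm is invariant under
adjoints, so the error does not grow. -/
theorem exists_mem_span_skewRank (hq : 1 ≤ q) {ρ : H →L[ℂ] H} (hρ : ρ ∈ u1q Hp q) {ε : ℝ}
    (hε : 0 < ε) : ∃ D ∈ Submodule.span ℝ {T : H →L[ℂ] H | ∃ z w, T = skewRank z w},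
      enorm1q Hp q (ρ - D) ≤ ENNReal.ofReal ε := by
  obtain ⟨R, hR, h⟩ := exists_finiteRank_enorm1q_sub_le Hp hq hρ.2 hε
  refine ⟨_, sub_adjoint_mem_span hR (1 / 2), ?_⟩
  have hs : ρ.adjoint = -ρ := hρ.1
  have h1 : ρ - ((1 / 2 : ℂ) • R - ((1 / 2 : ℂ) • R).adjoint) =
      (1 / 2 : ℂ) • (ρ - R) + (-(1 / 2 : ℂ)) • (ρ - R).adjoint := by
    have h2 : (starRingEnd ℂ) (1 / 2 : ℂ) = 1 / 2 := Complex.conj_eq_iff_im.2 (by norm_num)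
    rw [map_sub, hs, map_smulₛₗ, h2]
    module
  rw [h1]
  refine (enorm1q_add_le Hp hq _ _).trans ?_
  rw [enorm1q_smul Hp hq, enorm1q_smul Hp hq, enorm1q_adjoint Hp hq, ← add_mul, enorm_neg]
  have h3 : ‖(1 / 2 : ℂ)‖ₑ + ‖(1 / 2 : ℂ)‖ₑ = 1 := by
    rw [← ofReal_norm, ← ENNReal.ofReal_add (norm_nonneg _) (norm_nonneg _)]
    norm_num
  rw [h3, one_mul]
  exact h

/-- The trace is ⟨w, a z⟩ - ⟨z, a w⟩, and skewness makes the second term minus the conjugate of the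
first. -/
theorem trRes_mul_skewRank {a : H →L[ℂ] H} (ha : a ∈ skewHermitian H) (z w : H) :
    trRes Hp (a * skewRank z w) = ((2 * (⟪w, a z⟫_ℂ).re : ℝ) : ℂ) := by
  have h : a * skewRank z w = rankOne ℂ (a z) w + (-1 : ℂ) • rankOne ℂ (a w) z := by
    rw [skewRank, mul_sub, ContinuousLinearMap.mul_def, ContinuousLinearMap.mul_def, comp_rankOne,
      comp_rankOne]
    module
  have ha' : a.adjoint = -a := ha
  have h1 := L1q_of_mem_finiteRank Hp le_rfl (rankOne_mem_finiteRank (a z) w)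
  have h2 := L1q_of_mem_finiteRank Hp le_rfl (rankOne_mem_finiteRank (a w) z)
  have hw : ⟪z, a w⟫_ℂ = -(starRingEnd ℂ) ⟪w, a z⟫_ℂ := by
    rw [← ContinuousLinearMap.adjoint_inner_left, ha', neg_apply, inner_neg_left, inner_conj_symm]
  rw [h, trRes_add Hp le_rfl h1 (L1q_smul Hp le_rfl _ h2), trRes_smul, trRes_rankOne,
    trRes_rankOne, hw, neg_one_mul, neg_neg, Complex.add_conj]

end Restricted

/-! ### The duality map and its bijectivity -/

section Duality

open InnerProductSpace

variable {H : Type*} [NormedAddCommGroup H] [InnerProductSpace ℂ H] [CompleteSpace H]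
variable (Hp : Submodule ℂ H) [CompleteSpace Hp] {p q : ℝ≥0∞}

theorem IsNormedSubspace.Space.val_injective {V : Type*} [AddCommGroup V] [Module ℝ V] {S : Set V}
    {N : V → ℝ} {h : IsNormedSubspace S N} :
    Function.Injective (IsNormedSubspace.Space.val : h.Space → V) := Subtype.val_injective

/-- An element of a normed subspace, from a member of the underlying set. -/
def IsNormedSubspace.toSpace {V : Type*} [AddCommGroup V] [Module ℝ V] {S : Set V}
    {N : V → ℝ} (h : IsNormedSubspace S N) (x : V) (hx : x ∈ S) : h.Space :=
  (⟨x, hx⟩ : h.toSubmodule)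

theorem IsNormedSubspace.Space.val_mem {V : Type*} [AddCommGroup V] [Module ℝ V] {S : Set V}
    {N : V → ℝ} {h : IsNormedSubspace S N} (x : h.Space) : x.val ∈ S := x.2

/-- The pairing `(a, ρ) ↦ Tr_res (a ρ)`, with complex values. -/
noncomputable def pairing (hp : 1 ≤ p) (hq : 1 ≤ q) (hpq : p⁻¹ + q⁻¹ = 1) :
    (isNormedSubspace_uRes Hp hp).Space →L[ℝ] (isNormedSubspace_u1q Hp hq).Space →L[ℝ] ℂ :=
  LinearMap.mkContinuous₂
    (LinearMap.mk₂ ℝ (fun a ρ => trRes Hp (a.val * ρ.val))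
      (fun a b ρ => by
        change trRes Hp ((a.val + b.val) * ρ.val) = _
        rw [add_mul]
        exact trRes_add Hp hq (mul_mem_L1q Hp hp hq hpq a.val_mem.2 ρ.val_mem.2)
          (mul_mem_L1q Hp hp hq hpq b.val_mem.2 ρ.val_mem.2))
      (fun c a ρ => by
        change trRes Hp ((c • a.val) * ρ.val) = _
        rw [smul_mul_assoc, real_smul_eq, trRes_smul, Complex.real_smul])
      (fun a ρ σ => by
        change trRes Hp (a.val * (ρ.val + σ.val)) = _
        rw [mul_add]
        exact trRes_add Hp hq (mul_mem_L1q Hp hp hq hpq a.val_mem.2 ρ.val_mem.2)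
          (mul_mem_L1q Hp hp hq hpq a.val_mem.2 σ.val_mem.2))
      (fun c a ρ => by
        change trRes Hp (a.val * (c • ρ.val)) = _
        rw [mul_smul_comm, real_smul_eq, trRes_smul, Complex.real_smul]))
    1 (fun a ρ => by
      change ‖trRes Hp (a.val * ρ.val)‖ ≤ 1 * normRes Hp p a.val * norm1q Hp q ρ.val
      rw [one_mul, normRes_eq Hp hp a.val_mem.2, norm1q_eq Hp hq ρ.val_mem.2, ← ENNReal.toReal_mul, ← toReal_enorm]
      exact ENNReal.toReal_mono
        (ENNReal.mul_ne_top (enormRes_ne_top Hp hp a.val_mem.2) (enorm1q_ne_top Hp hq ρ.val_mem.2))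
        (enorm_trRes_mul_le Hp hp hq hpq a.val_mem.2 ρ.val_mem.2))

theorem pairing_apply (hp : 1 ≤ p) (hq : 1 ≤ q) (hpq : p⁻¹ + q⁻¹ = 1)
    (a : (isNormedSubspace_uRes Hp hp).Space) (ρ : (isNormedSubspace_u1q Hp hq).Space) :
    pairing Hp hp hq hpq a ρ = trRes Hp (a.val * ρ.val) := rfl

/-- The operator `z w* - w z*`, as an element of `𝔲_{1,q}`. -/
noncomputable def skewRankSpace (hq : 1 ≤ q) (z w : H) : (isNormedSubspace_u1q Hp hq).Space :=
  (isNormedSubspace_u1q Hp hq).toSpace (skewRank z w) (skewRank_mem_u1q Hp hq z w)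

/-- Both functionals are continuous and the operators z w* - w z* have dense real span. -/
theorem functional_ext (hq : 1 ≤ q)
    {φ ψ : (isNormedSubspace_u1q Hp hq).Space →L[ℝ] ℝ}
    (h : ∀ z w, φ (skewRankSpace Hp hq z w) = ψ (skewRankSpace Hp hq z w)) : φ = ψ := by
  have key : ∀ D ∈ Submodule.span ℝ {T : H →L[ℂ] H | ∃ z w, T = skewRank z w},
      ∃ x : (isNormedSubspace_u1q Hp hq).Space, x.val = D ∧ φ x = ψ x := by
    intro D hD
    induction hD using Submodule.span_induction with
    | mem T hT =>
      obtain ⟨z, w, rfl⟩ := hT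
      exact ⟨skewRankSpace Hp hq z w, rfl, h z w⟩
    | zero => exact ⟨0, rfl, by rw [map_zero, map_zero]⟩
    | add S T _ _ hS hT =>
      obtain ⟨x, rfl, hx⟩ := hS
      obtain ⟨y, rfl, hy⟩ := hT
      exact ⟨x + y, rfl, by rw [map_add, map_add, hx, hy]⟩
    | smul c T _ hT =>
      obtain ⟨x, rfl, hx⟩ := hT
      exact ⟨c • x, rfl, by rw [map_smul, map_smul, hx]⟩
  rw [← sub_eq_zero]
  ext ρ
  rw [zero_apply, ← norm_eq_zero]
  refine le_antisymm (le_of_forall_pos_le_add fun δ hδ => ?_) (norm_nonneg _)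
  have hpos : 0 < δ / (‖φ - ψ‖ + 1) := by positivity
  obtain ⟨D, hD, hρD⟩ := exists_mem_span_skewRank Hp hq ρ.val_mem hpos
  obtain ⟨x, rfl, hx⟩ := key D hD
  have h1 : (φ - ψ) ρ = (φ - ψ) (ρ - x) := by
    rw [map_sub, sub_apply φ ψ x, hx, sub_self, sub_zero]
  have h2 : ‖ρ - x‖ ≤ δ / (‖φ - ψ‖ + 1) := by
    change norm1q Hp q (ρ - x).val ≤ _
    rw [norm1q_eq Hp hq (ρ - x).val_mem.2]
    exact ENNReal.toReal_le_of_le_ofReal hpos.le hρD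
  rw [h1, zero_add]
  calc ‖(φ - ψ) (ρ - x)‖ ≤ ‖φ - ψ‖ * (δ / (‖φ - ψ‖ + 1)) :=
        (ContinuousLinearMap.le_opNorm _ _).trans (by gcongr)
    _ ≤ δ := by
        rw [mul_div_assoc', div_le_iff₀ (by positivity)]
        nlinarith [norm_nonneg (φ - ψ)]

theorem pairing_skewRankSpace (hp : 1 ≤ p) (hq : 1 ≤ q) (hpq : p⁻¹ + q⁻¹ = 1)
    (a : (isNormedSubspace_uRes Hp hp).Space) (z w : H) :
    pairing Hp hp hq hpq a (skewRankSpace Hp hq z w) = ((2 * (⟪w, a.val z⟫_ℂ).re : ℝ) : ℂ) :=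
  trRes_mul_skewRank Hp a.val_mem.1 z w

/-- The imaginary part is a continuous real functional of ρ that vanishes on the operators z w* - w
z*. -/
theorem im_pairing (hp : 1 ≤ p) (hq : 1 ≤ q) (hpq : p⁻¹ + q⁻¹ = 1)
    (a : (isNormedSubspace_uRes Hp hp).Space) (ρ : (isNormedSubspace_u1q Hp hq).Space) :
    (pairing Hp hp hq hpq a ρ).im = 0 := by
  have h : Complex.imCLM ∘L pairing Hp hp hq hpq a = 0 := functional_ext Hp hq fun z w => by
    rw [ContinuousLinearMap.comp_apply, pairing_skewRankSpace]
    simp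
  exact DFunLike.congr_fun h ρ

/-- The map `a ↦ (ρ ↦ Tr_res (a ρ))` into the real dual of `𝔲_{1,q}`. -/
noncomputable def dualityMap (hp : 1 ≤ p) (hq : 1 ≤ q) (hpq : p⁻¹ + q⁻¹ = 1) :
    (isNormedSubspace_uRes Hp hp).Space →L[ℝ] StrongDual ℝ (isNormedSubspace_u1q Hp hq).Space :=
  (ContinuousLinearMap.compL ℝ _ ℂ ℝ Complex.reCLM) ∘L pairing Hp hp hq hpq

theorem dualityMap_apply (hp : 1 ≤ p) (hq : 1 ≤ q) (hpq : p⁻¹ + q⁻¹ = 1)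
    (a : (isNormedSubspace_uRes Hp hp).Space) (ρ : (isNormedSubspace_u1q Hp hq).Space) :
    dualityMap Hp hp hq hpq a ρ = (pairing Hp hp hq hpq a ρ).re := rfl

theorem ofReal_dualityMap (hp : 1 ≤ p) (hq : 1 ≤ q) (hpq : p⁻¹ + q⁻¹ = 1)
    (a : (isNormedSubspace_uRes Hp hp).Space) (ρ : (isNormedSubspace_u1q Hp hq).Space) :
    ((dualityMap Hp hp hq hpq a ρ : ℝ) : ℂ) = trRes Hp (a.val * ρ.val) := by
  rw [dualityMap_apply, ← pairing_apply Hp hp hq hpq]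
  exact Complex.ext rfl (im_pairing Hp hp hq hpq a ρ).symm

theorem dualityMap_skewRankSpace (hp : 1 ≤ p) (hq : 1 ≤ q) (hpq : p⁻¹ + q⁻¹ = 1)
    (a : (isNormedSubspace_uRes Hp hp).Space) (z w : H) :
    dualityMap Hp hp hq hpq a (skewRankSpace Hp hq z w) = 2 * (⟪w, a.val z⟫_ℂ).re := by
  rw [dualityMap_apply, pairing_skewRankSpace, Complex.ofReal_re]

theorem dualityMap_injective (hp : 1 ≤ p) (hq : 1 ≤ q) (hpq : p⁻¹ + q⁻¹ = 1) :
    Function.Injective (dualityMap Hp hp hq hpq) := by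
  rw [injective_iff_map_eq_zero]
  intro a ha
  refine IsNormedSubspace.Space.val_injective ?_
  change a.val = 0
  ext z
  -- The choice w = a z turns the pairing into 2‖a z‖².
  have h := dualityMap_skewRankSpace Hp hp hq hpq a z (a.val z)
  rw [ha, zero_apply] at h
  have h2 : RCLike.re ⟪a.val z, a.val z⟫_ℂ = ‖a.val z‖ ^ 2 := inner_self_eq_norm_sq _
  have h3 : (⟪a.val z, a.val z⟫_ℂ).re = ‖a.val z‖ ^ 2 := h2
  rw [h3] at h
  have h4 : ‖a.val z‖ = 0 := by nlinarith [norm_nonneg (a.val z)]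
  simpa using h4

/-! ### Representation of functionals -/

theorem skewRank_add_left (z z' w : H) : skewRank (z + z') w = skewRank z w + skewRank z' w := by
  simp only [skewRank, map_add, add_apply]; abel

theorem skewRank_swap (z w : H) : skewRank w z = -skewRank z w := by
  simp only [skewRank, neg_sub]

theorem skewRank_smul_left (c : ℝ) (z w : H) : skewRank ((c : ℂ) • z) w = c • skewRank z w := by
  simp only [skewRank, map_smul, map_smulₛₗ, smul_apply, Complex.conj_ofReal, real_smul_eq, smul_sub]

/-- The only relation that involves the complex structure; it makes the form built from φ complex
sesquilinear. -/
theorem skewRank_I_smul (z w : H) :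
    skewRank (Complex.I • z) (Complex.I • w) = skewRank z w := by
  simp only [skewRank, map_smul, map_smulₛₗ, smul_apply, smul_smul, Complex.conj_I]
  simp

theorem norm1q_skewRank_le (hq : 1 ≤ q) (z w : H) :
    norm1q Hp q (skewRank z w) ≤ 8 * (‖z‖ * ‖w‖) := by
  rw [norm1q_eq Hp hq (skewRank_mem_u1q Hp hq z w).2]
  refine ENNReal.toReal_le_of_le_ofReal (by positivity) ?_
  -- There are four blocks, each a difference of two operators of rank at most one: 8 in all.
  have h {L K : Submodule ℂ H} [CompleteSpace L] [CompleteSpace K] {r : ℝ≥0∞} (hr : 1 ≤ r) :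
      schattenENorm r (block L K (skewRank z w)) ≤ ENNReal.ofReal (2 * (‖z‖ * ‖w‖)) := by
    refine (schattenENorm_block_le hr _).trans ((schattenENorm_sub_le hr _ _).trans ?_)
    refine (add_le_add (schattenENorm_rankOne_le hr z w) (schattenENorm_rankOne_le hr w z)).trans
      (le_of_eq ?_)
    rw [← ofReal_norm, ← ofReal_norm, ← ENNReal.ofReal_mul (norm_nonneg _),
      ← ENNReal.ofReal_mul (norm_nonneg _), ← ENNReal.ofReal_add (by positivity) (by positivity)]
    congr 1
    ring
  refine (add_le_add (add_le_add (add_le_add (h le_rfl) (h le_rfl)) (h hq)) (h hq)).trans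
    (le_of_eq ?_)
  rw [← ENNReal.ofReal_add (by positivity) (by positivity),
    ← ENNReal.ofReal_add (by positivity) (by positivity),
    ← ENNReal.ofReal_add (by positivity) (by positivity)]
  congr 1
  ring

section Representation

variable (hq : 1 ≤ q) (φ : StrongDual ℝ (isNormedSubspace_u1q Hp hq).Space)

theorem functional_add_left (z z' w : H) : φ (skewRankSpace Hp hq (z + z') w) =
    φ (skewRankSpace Hp hq z w) + φ (skewRankSpace Hp hq z' w) := by
  rw [← map_add]
  exact congrArg φ (IsNormedSubspace.Space.val_injective (skewRank_add_left z z' w))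

theorem functional_swap (z w : H) :
    φ (skewRankSpace Hp hq w z) = -φ (skewRankSpace Hp hq z w) := by
  rw [← map_neg]
  exact congrArg φ (IsNormedSubspace.Space.val_injective (skewRank_swap z w))

theorem functional_smul_left (c : ℝ) (z w : H) :
    φ (skewRankSpace Hp hq ((c : ℂ) • z) w) = c * φ (skewRankSpace Hp hq z w) := by
  rw [← smul_eq_mul, ← map_smul]
  exact congrArg φ (IsNormedSubspace.Space.val_injective (skewRank_smul_left c z w))

theorem functional_I_smul (z w : H) :
    φ (skewRankSpace Hp hq (Complex.I • z) (Complex.I • w)) = φ (skewRankSpace Hp hq z w) :=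
  congrArg φ (IsNormedSubspace.Space.val_injective (skewRank_I_smul z w))

theorem functional_I_smul_left (z w : H) :
    φ (skewRankSpace Hp hq (Complex.I • z) w) = -φ (skewRankSpace Hp hq z (Complex.I • w)) := by
  rw [← functional_I_smul, smul_smul, Complex.I_mul_I]
  have h := functional_smul_left Hp hq φ (-1) z (Complex.I • w)
  simpa using h

theorem functional_complex_smul_left (c : ℂ) (z w : H) :
    φ (skewRankSpace Hp hq (c • z) w) =
      c.re * φ (skewRankSpace Hp hq z w) - c.im * φ (skewRankSpace Hp hq z (Complex.I • w)) := by
  conv_lhs => rw [← Complex.re_add_im c, add_smul, mul_smul]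
  rw [functional_add_left, functional_smul_left, functional_smul_left, functional_I_smul_left]
  ring

theorem norm_functional_le (z w : H) :
    |φ (skewRankSpace Hp hq z w)| ≤ ‖φ‖ * (8 * (‖z‖ * ‖w‖)) := by
  refine (φ.le_opNorm _).trans ?_
  gcongr
  exact norm1q_skewRank_le Hp hq z w

/-- The complex number `⟨a z, w⟩`, for the operator `a` which represents `φ`. -/
noncomputable def sesqValue (z w : H) : ℂ :=
  -- If φ(z w* - w z*) = 2 Re⟨a z, w⟩, the real part is half this value, and replacing w by iw gives
  -- minus the imaginary part.
  (1 / 2 : ℂ) * (φ (skewRankSpace Hp hq z w) -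
    Complex.I * φ (skewRankSpace Hp hq z (Complex.I • w)))

theorem sesqValue_add_left (z z' w : H) : sesqValue Hp hq φ (z + z') w =
    sesqValue Hp hq φ z w + sesqValue Hp hq φ z' w := by
  simp only [sesqValue, functional_add_left, Complex.ofReal_add]
  ring

theorem sesqValue_smul_left (c : ℂ) (z w : H) :
    sesqValue Hp hq φ (c • z) w = (starRingEnd ℂ) c * sesqValue Hp hq φ z w := by
  have h : φ (skewRankSpace Hp hq z (Complex.I • Complex.I • w)) =
      -φ (skewRankSpace Hp hq z w) := by
    have h1 := functional_I_smul_left Hp hq φ z (Complex.I • w)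
    rw [functional_I_smul] at h1
    linarith
  simp only [sesqValue, functional_complex_smul_left, h]
  apply Complex.ext <;> simp <;> ring

/-- Gives linearity in the second variable from the first, and the skewness of the representing
operator. -/
theorem sesqValue_swap (z w : H) :
    sesqValue Hp hq φ w z = -(starRingEnd ℂ) (sesqValue Hp hq φ z w) := by
  have h : φ (skewRankSpace Hp hq w (Complex.I • z)) =
      φ (skewRankSpace Hp hq z (Complex.I • w)) := by
    rw [functional_swap, functional_I_smul_left, neg_neg]
  simp only [sesqValue, h, functional_swap Hp hq φ z w]
  apply Complex.ext <;> simp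

theorem norm_sesqValue_le (z w : H) : ‖sesqValue Hp hq φ z w‖ ≤ 8 * ‖φ‖ * ‖z‖ * ‖w‖ := by
  have h1 := norm_functional_le Hp hq φ z w
  have h2 := norm_functional_le Hp hq φ z (Complex.I • w)
  rw [norm_smul, Complex.norm_I, one_mul] at h2
  rw [sesqValue, norm_mul]
  have h3 : ‖(φ (skewRankSpace Hp hq z w) : ℂ) -
      Complex.I * φ (skewRankSpace Hp hq z (Complex.I • w))‖ ≤
      |φ (skewRankSpace Hp hq z w)| + |φ (skewRankSpace Hp hq z (Complex.I • w))| := by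
    refine (norm_sub_le _ _).trans ?_
    rw [norm_mul, Complex.norm_I, one_mul, Complex.norm_real, Complex.norm_real, Real.norm_eq_abs,
      Real.norm_eq_abs]
  have h4 : ‖(1 / 2 : ℂ)‖ = 1 / 2 := by norm_num
  rw [h4]
  linarith

/-- The bounded sesquilinear form of a functional. -/
noncomputable def sesqForm : H →L⋆[ℂ] H →L[ℂ] ℂ :=
  LinearMap.mkContinuous₂
    (LinearMap.mk₂'ₛₗ (starRingEnd ℂ) (RingHom.id ℂ) (sesqValue Hp hq φ)
      (sesqValue_add_left Hp hq φ) (fun c z w => by rw [sesqValue_smul_left, smul_eq_mul])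
      (fun z w w' => by
        rw [sesqValue_swap, sesqValue_add_left, map_add, neg_add, ← sesqValue_swap,
          ← sesqValue_swap])
      (fun c z w => by
        rw [sesqValue_swap, sesqValue_smul_left, map_mul, Complex.conj_conj, ← mul_neg,
          ← sesqValue_swap, RingHom.id_apply, smul_eq_mul]))
    (8 * ‖φ‖) (norm_sesqValue_le Hp hq φ)

/-- The operator which represents a functional. -/
noncomputable def representative : H →L[ℂ] H := continuousLinearMapOfBilin (sesqForm Hp hq φ)

theorem inner_representative (z w : H) :
    ⟪representative Hp hq φ z, w⟫_ℂ = sesqValue Hp hq φ z w :=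
  continuousLinearMapOfBilin_apply _ _ _

theorem representative_mem_skewHermitian : representative Hp hq φ ∈ skewHermitian H := by
  change (representative Hp hq φ).adjoint = _
  ext z
  refine ext_inner_right ℂ fun w => ?_
  rw [ContinuousLinearMap.adjoint_inner_left, neg_apply, inner_neg_left, inner_representative,
    ← inner_conj_symm, inner_representative, sesqValue_swap, map_neg, Complex.conj_conj]

theorem re_inner_representative (z w : H) :
    (⟪w, representative Hp hq φ z⟫_ℂ).re = φ (skewRankSpace Hp hq z w) / 2 := by
  rw [← inner_conj_symm, inner_representative, Complex.conj_re, sesqValue]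
  simp
  ring

/-- A finite rank test operator m : H₊ → H₋, extended by zero to M, gives ρ = M - M* in 𝔲_{1,q}. Its
off-diagonal blocks are m and -m*, so ‖ρ‖ = 2‖m‖_q; the pairing of m with the block is φ(ρ)/2 in
real part, and the factors 2 cancel. -/
theorem schattenENorm_block_representative_le (hp : 1 ≤ p) (hp' : p ≠ ∞) (hpq : p⁻¹ + q⁻¹ = 1) :
    schattenENorm p (block Hp Hpᗮ (representative Hp hq φ)) ≤ ENNReal.ofReal ‖φ‖ := by
  refine schattenENorm_le_of_forall_finiteRank hp hp' hq hpq (norm_nonneg _) fun n c x y => ?_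
  set m : Hp →L[ℂ] Hpᗮ := ∑ j, c j • rankOne ℂ (x j) (y j) with hm
  set ρ : (isNormedSubspace_u1q Hp hq).Space :=
    ∑ j, skewRankSpace Hp hq (c j • (x j : H)) (y j : H) with hρ
  have hval : ρ.val = extend Hpᗮ Hp m - (extend Hpᗮ Hp m).adjoint := by
    have h1 : ρ.val = ∑ j, skewRank (c j • (x j : H)) (y j : H) :=
      map_sum (isNormedSubspace_u1q Hp hq).toSubmodule.subtype _ _
    have h2 : extend Hpᗮ Hp m = ∑ j, rankOne ℂ (c j • (x j : H)) (y j : H) := by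
      simp only [extend, hm, ContinuousLinearMap.finsetSum_comp, ContinuousLinearMap.comp_finsetSum,
        ContinuousLinearMap.smul_comp, ContinuousLinearMap.comp_smul, rankOne_comp, comp_rankOne,
        Submodule.adjoint_orthogonalProjectionOnto, Submodule.subtypeL_apply, map_smul, smul_apply]
    rw [h1, h2, map_sum, ← Finset.sum_sub_distrib]
    exact Finset.sum_congr rfl fun j _ => by rw [adjoint_rankOne]; rfl
  have o1 : Hp ⟂ Hpᗮ := Submodule.isOrtho_orthogonal_right Hp
  have o2 : Hpᗮ ⟂ Hp := Submodule.isOrtho_orthogonal_left Hp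
  have hmfin : m ∈ finiteRank Hp Hpᗮ :=
    sum_mem fun j _ => Submodule.smul_mem _ _ (rankOne_mem_finiteRank _ _)
  have hmq : schattenENorm q m ≠ ∞ :=
    ((memSchatten_of_mem_finiteRank hq hmfin).schattenENorm_lt_top hq).ne
  have hnorm : ‖ρ‖ ≤ 2 * (schattenENorm q m).toReal := by
    change norm1q Hp q ρ.val ≤ _
    rw [norm1q_eq Hp hq ρ.val_mem.2, hval]
    simp only [enorm1q, block_sub, block_adjoint, block_extend_self,
      block_extend_of_orthogonal_left _ _ o1, block_extend_of_orthogonal_right _ _ o2, map_zero,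
      sub_zero, zero_sub, schattenENorm_zero le_rfl, zero_add,
      schattenENorm_neg hq, schattenENorm_adjoint hq]
    rw [ENNReal.toReal_add hmq hmq, two_mul]
  have hsum : (∑ j, c j * ⟪y j, block Hp Hpᗮ (representative Hp hq φ) (x j)⟫_ℂ).re = φ ρ / 2 := by
    rw [hρ, map_sum, Complex.re_sum, Finset.sum_div]
    refine Finset.sum_congr rfl fun j _ => ?_
    rw [← re_inner_representative, map_smul, inner_smul_right, block_apply, Submodule.coe_inner]
    congr 2
    rw [Submodule.coe_orthogonalProjectionOnto_apply, ← Submodule.inner_starProjection_left_eq_right,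
      Submodule.starProjection_eq_self_iff.2 (y j).2]
  rw [hsum]
  have := (le_abs_self _).trans (φ.le_opNorm ρ)
  nlinarith [norm_nonneg φ]

/-- The bound p ≤ 2 turns the norm estimate into membership; the other block is minus the adjoint of
this one. -/
theorem representative_mem_uRes (hp : 1 ≤ p) (hp2 : p ≤ 2) (hpq : p⁻¹ + q⁻¹ = 1) :
    representative Hp hq φ ∈ uRes Hp p := by
  have hp' : p ≠ ∞ := ne_top_of_le_ne_top ENNReal.ofNat_ne_top hp2
  have h1 : MemSchatten p (block Hp Hpᗮ (representative Hp hq φ)) :=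
    memSchatten_of_schattenENorm_ne_top hp hp2 (ne_top_of_le_ne_top ENNReal.ofReal_ne_top
      (schattenENorm_block_representative_le Hp hq φ hp hp' hpq))
  have hs := representative_mem_skewHermitian Hp hq φ
  have h2 : MemSchatten p (block Hpᗮ Hp (representative Hp hq φ)) := by
    have h3 := (h1.adjoint hp).smul hp (-1)
    rw [← block_adjoint, show (representative Hp hq φ).adjoint = _ from hs, block_neg,
      neg_one_smul, neg_neg] at h3
    exact h3
  exact ⟨hs, (memSchatten_commD_iff Hp hp).2 ⟨h1, h2⟩⟩

end Representation

theorem dualityMap_surjective (hp : 1 ≤ p) (hp2 : p ≤ 2) (hq : 1 ≤ q) (hpq : p⁻¹ + q⁻¹ = 1) :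
    Function.Surjective (dualityMap Hp hp hq hpq) := fun φ => by
  refine ⟨(isNormedSubspace_uRes Hp hp).toSpace _ (representative_mem_uRes Hp hq φ hp hp2 hpq),
    functional_ext Hp hq fun z w => ?_⟩
  rw [dualityMap_skewRankSpace]
  change 2 * (⟪w, representative Hp hq φ z⟫_ℂ).re = _
  rw [re_inner_representative]
  ring

end Duality

end SchattenRestricted

theorem mainTheorem8 {H : Type*} [NormedAddCommGroup H] [InnerProductSpace ℂ H] [CompleteSpace H]
    [TopologicalSpace.SeparableSpace H]
    (Hp : Submodule ℂ H) [CompleteSpace Hp]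
    (hHp : ¬ FiniteDimensional ℂ Hp) (hHm : ¬ FiniteDimensional ℂ Hpᗮ)
    (p q : ℝ≥0∞) (hp1 : 1 ≤ p) (hp2 : p ≤ 2) (hpq : p⁻¹ + q⁻¹ = 1) :
    ∃ (hU : SchattenRestricted.IsNormedSubspace
          (SchattenRestricted.u1q Hp q) (SchattenRestricted.norm1q Hp q))
      (hR : SchattenRestricted.IsNormedSubspace
          (SchattenRestricted.uRes Hp p) (SchattenRestricted.normRes Hp p)),
      CompleteSpace hU.Space ∧ CompleteSpace hR.Space ∧
      (∀ (a : hR.Space) (ρ : hU.Space), a.val * ρ.val ∈ SchattenRestricted.L1q Hp q) ∧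
      ∃ Φ : hR.Space ≃L[ℝ] StrongDual ℝ hU.Space,
        ∀ (a : hR.Space) (ρ : hU.Space),
          ((Φ a ρ : ℝ) : ℂ) = SchattenRestricted.trRes Hp (a.val * ρ.val) := by
  -- The case p = 1 is included, with q = ∞ because ∞⁻¹ = 0.
  have hq : 1 ≤ q := by
    rw [← ENNReal.inv_le_one, ← hpq]
    exact le_add_self
  have hR := SchattenRestricted.completeSpace_uRes Hp hp1
  exact ⟨SchattenRestricted.isNormedSubspace_u1q Hp hq,
    SchattenRestricted.isNormedSubspace_uRes Hp hp1,
    SchattenRestricted.completeSpace_u1q Hp hq, hR,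
    fun a ρ => SchattenRestricted.mul_mem_L1q Hp hp1 hq hpq a.val_mem.2 ρ.val_mem.2,
    -- The open mapping theorem makes the inverse continuous; this uses that 𝔲_{res,p} is complete.
    ContinuousLinearEquiv.ofBijective (SchattenRestricted.dualityMap Hp hp1 hq hpq)
      (LinearMap.ker_eq_bot.2 (SchattenRestricted.dualityMap_injective Hp hp1 hq hpq))
      (LinearMap.range_eq_top.2 (SchattenRestricted.dualityMap_surjective Hp hp1 hp2 hq hpq)),
    SchattenRestricted.ofReal_dualityMap Hp hp1 hq hpq⟩
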